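/- Let $K,M\ge 0$ and $N\ge 1$ be integers. Let $E=\mathbb S^{K+2}\times\mathbb R^{K+1}$ (symmetric matrices times vectors) carry the inner product $\langle (A,b),(G,F)\rangle=\operatorname{Tr}(A^{\top}G)+b^{\top}F$ and the norm $\|(G,F)\|=\sqrt{\|G\|_F^2+\|F\|^2}$, with dual norm $\|\cdot\|_*$. Let $(A_{\mathrm{obj}},b_{\mathrm{obj}}),(A_0,b_0)\in E$, $c_0\in\mathbb R$ and, for each $\theta$ in a parameter set $\Theta$, $(A_m(\theta),b_m(\theta))\in E$ for $m=1,\dots,M$. Put $\ell(G,F)=\operatorname{Tr}(A_{\mathrm{obj}}^{\top}G)+b_{\mathrm{obj}}^{\top}F$, $(\mathcal L_\theta(G,F))_m=-\operatorname{Tr}(A_m(\theta)^{\top}G)-b_m(\theta)^{\top}F$, with adjoint $\mathcal L_\theta^*(y)=-\sum_m y_m(A_m(\theta),b_m(\theta))$, and $$S^\theta=\{(G,F)\in\mathbb S_+^{K+2}\times\mathbb R^{K+1}:\ \mathcal L_\theta(G,F)\in\mathbb R^M_+,\ \operatorname{Tr}(A_0^{\top}G)+b_0^{\top}F+c_0\le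 0\}.$$ Fix $\theta\in\Theta$, $\varepsilon>0$, and points $\hat\xi_i=(\widehat G_i,\widehat F_i)\in S^\theta$, $i=1,\dots,N$, with empirical distribution $\widehat{\mathbb P}=\frac1N\sum_i\delta_{\hat\xi_i}$. Let $W_1$ be the 1-Wasserstein distance induced by $\|\cdot\|$. Consider three problems. (DRO-PEP): maximize $\mathbb E_{\mathbb Q}[\ell(G,F)]$ over probability measures $\mathbb Q$ on $E$ with $\operatorname{supp}\mathbb Q\subseteq S^\theta$ and $W_1(\widehat{\mathbb P},\mathbb Q)\le\varepsilon$. (DRO-PEP-D): minimize $\frac1N\sum_i s_i$ over $s_i\in\mathbb R$, $\tau_i\ge0$, $(X_i,Y_i)\in E$, $y_i\in\mathbb R^M_+$, $\lambda\ge0$ subject to, for all $i$, $-c_0\tau_i-\langle(X_i,Y_i),\hat\xi_i\rangle+\lambda\varepsilon\le s_i$, $\ -\mathcal L_\theta^*(y_i)-(X_i,Y_i)+\tau_i(A_0,b_0)-(A_{\mathrm{obj}},b_{\mathrm{obj}})\in\mathbb S_+^{K+2}\times\{0\}$ and $\|(X_i,Y_i)\|_*\le\lambda$. (DRO-PEP-P):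 maximize $\frac1N\sum_i\ell(G_i,F_i)$ subject to $\frac1N\sum_i\|(G_i,F_i)-\hat\xi_i\|\le\varepsilon$ and $(G_i,F_i)\in S^\theta$, $i=1,\dots,N$. Then all expectations in (DRO-PEP) are finite, and (DRO-PEP-P) is a bi-dual of (DRO-PEP), in the following sense. (a) (DRO-PEP-D) is a dual of (DRO-PEP). The dual function of (DRO-PEP) for the constraint $W_1\le\varepsilon$ with multiplier $\lambda\ge0$, the decision variable ranging over the $\mathbb Q$ with $\operatorname{supp}\mathbb Q\subseteq S^\theta$ and $W_1(\widehat{\mathbb P},\mathbb Q)<\infty$, is $\lambda\varepsilon+\frac1N\sum_i\sup_{\xi\in S^\theta}(\ell(\xi)-\lambda\|\xi-\hat\xi_i\|)$. Write the $i$-th supremum as the problem: maximize $\ell(\xi)-\lambda\|\zeta\|$ over $\xi\in\mathbb S^{K+2}_+\times\mathbb R^{K+1}$, $\zeta\in E$ subject to $\zeta=\xi-\hat\xi_i$, $\mathcal L_\theta(\xi)\ge0$, $\langle(A_0,b_0),\xi\rangle+c_0\le0$; and let $h_i$ be its Lagrangian dual function, with multipliers $(X_i,Y_i)\in E$, $y_i\ge0$,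 $\tau_i\ge0$. Then for all fixed $\lambda\ge0$, $(X_i,Y_i)$, $y_i\ge 0$, $\tau_i\ge 0$, the infimum of the objective of (DRO-PEP-D) over the feasible $s$ is $\lambda\varepsilon+\frac1N\sum_i h_i(\lambda;X_i,Y_i,\tau_i,y_i)$ (both may be $+\infty$). (b) (DRO-PEP-P) is the Lagrangian dual of (DRO-PEP-D): dualize the three families of constraints of (DRO-PEP-D) with multipliers $\mu_i\ge0$, $\Gamma_i\in\mathbb S^{K+2}_+\times\mathbb R^{K+1}$ and $(V_i,r_i)$ with $\|V_i\|\le r_i$, respectively, and write $\Gamma_i=\frac1N(G_i,F_i)$. For every $(G_i,F_i)_i\in E^N$, the supremum of the Lagrangian dual function over the remaining multipliers $\mu,V,r$ is $\frac1N\sum_i\ell(G_i,F_i)$ if $(G_i,F_i)_i$ is feasible for (DRO-PEP-P), and $-\infty$ otherwise. Moreover, the optimal values of (DRO-PEP), (DRO-PEP-D) and (DRO-PEP-P) coincide, and (DRO-PEP-P) has an optimal solution. -/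

import Mathlib

open MeasureTheory
open scoped ENNReal

noncomputable section

namespace DROPEP

/-- The subspace of `ℝ^((K+2) × (K+2)) × ℝ^(K+1)`, with its Euclidean norm, of the pairs `(G, F)`
with `G` symmetric. The entries of `G` are the coordinates `Sum.inl (i, j)`, those of `F` are the
coordinates `Sum.inr k`. -/
def liftedSubmodule (K : ℕ) :
    Submodule ℝ (EuclideanSpace ℝ ((Fin (K + 2) × Fin (K + 2)) ⊕ Fin (K + 1))) where
  carrier := {ξ | ∀ i j, ξ (Sum.inl (i, j)) = ξ (Sum.inl (j, i))}
  add_mem' := fun ha hb i j => congrArg₂ (· + ·) (ha i j) (hb i j)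
  zero_mem' := fun _ _ => rfl
  smul_mem' := fun c _ ha i j => congrArg (c * ·) (ha i j)

/-- The space of pairs `(G, F)` with `G` a symmetric `(K+2) × (K+2)` matrix and `F ∈ ℝ^(K+1)`,
with the norm `√(‖G‖_F² + ‖F‖²)` (see `norm_lifted`). -/
abbrev Lifted (K : ℕ) : Type := liftedSubmodule K

variable {Θ : Type*} {K M N : ℕ}

/-- The matrix component `G` of `(G, F)`. -/
def gram (ξ : Lifted K) : Matrix (Fin (K + 2)) (Fin (K + 2)) ℝ :=
  Matrix.of fun i j => ξ.1 (Sum.inl (i, j))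

/-- The vector component `F` of `(G, F)`. -/
def fval (ξ : Lifted K) : Fin (K + 1) → ℝ := fun k => ξ.1 (Sum.inr k)

/-- The pairing `⟨(A, b), (G, F)⟩ = Tr(Aᵀ G) + bᵀ F`. -/
def pairing (a ξ : Lifted K) : ℝ := ((gram a).transpose * gram ξ).trace + fval a ⬝ᵥ fval ξ

theorem norm_lifted (ξ : Lifted K) :
    ‖ξ‖ = √(∑ i, ∑ j, (gram ξ i j) ^ 2 + ∑ k, (fval ξ k) ^ 2) := by
  rw [Submodule.coe_norm, EuclideanSpace.norm_eq, Fintype.sum_sum_type, Fintype.sum_prod_type]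
  simp [gram, fval]

theorem pairing_eq_inner (a ξ : Lifted K) : pairing a ξ = inner ℝ a ξ := by
  rw [Submodule.coe_inner, PiLp.inner_apply, Fintype.sum_sum_type, Fintype.sum_prod_type,
    Finset.sum_comm, pairing]
  exact congrArg₂ (· + ·)
    (Finset.sum_congr rfl fun i _ => (Matrix.mul_apply (M := (gram a).transpose)).trans
      (Finset.sum_congr rfl fun j _ => mul_comm (gram a j i) (gram ξ j i)))
    (Finset.sum_congr rfl fun k _ => mul_comm _ _)

/-- The dual norm `sup {⟨X, η⟩ : ‖η‖ ≤ 1}`. -/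
def dualNorm (X : Lifted K) : ℝ := sSup (pairing X '' {η | ‖η‖ ≤ 1})

/-- The cone `𝕊₊ × ℝ^(K+1)`. -/
def psdCone (K : ℕ) : Set (Lifted K) := {ξ | (gram ξ).PosSemidef}

/-- The cone `𝕊₊ × {0}`. -/
def psdZeroCone (K : ℕ) : Set (Lifted K) := {ξ | (gram ξ).PosSemidef ∧ fval ξ = 0}

/-- The coefficients of a lifted performance estimation problem: `obj = (A_obj, b_obj)`,
`init = (A_0, b_0)`, `c₀`, and `lmi θ m = (A_m(θ), b_m(θ))`. -/
structure PEPData (Θ : Type*) (K M : ℕ) where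
  obj : Lifted K
  init : Lifted K
  c₀ : ℝ
  lmi : Θ → Fin M → Lifted K

namespace PEPData

variable (D : PEPData Θ K M) (θ : Θ) (ξhat : Fin N → Lifted K) (ε : ℝ)

/-- The loss `ℓ(G, F) = Tr(A_objᵀ G) + b_objᵀ F`. -/
def loss (ξ : Lifted K) : ℝ := pairing D.obj ξ

/-- The linear map `𝓛_θ(G, F)_m = -Tr(A_m(θ)ᵀ G) - b_m(θ)ᵀ F`. -/
def linMap (ξ : Lifted K) : Fin M → ℝ := fun m => -pairing (D.lmi θ m) ξ

/-- The adjoint map `𝓛_θ^*(y) = -∑_m y_m (A_m(θ), b_m(θ))`. -/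
def linAdj (y : Fin M → ℝ) : Lifted K := -∑ m, y m • D.lmi θ m

/-- The left-hand side `Tr(A_0ᵀ G) + b_0ᵀ F + c_0` of the initial condition. -/
def initial (ξ : Lifted K) : ℝ := pairing D.init ξ + D.c₀

/-- The support set `S^θ`. -/
def suppSet : Set (Lifted K) :=
  {ξ | ξ ∈ psdCone K ∧ (∀ m, 0 ≤ D.linMap θ ξ m) ∧ D.initial ξ ≤ 0}

end PEPData

/-- The empirical distribution `(1/N) ∑ᵢ δ_{ξ̂ᵢ}`. -/
def empirical (ξhat : Fin N → Lifted K) : Measure (Lifted K) :=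
  (N : ℝ≥0∞)⁻¹ • ∑ i, Measure.dirac (ξhat i)

/-- The 1-Wasserstein distance: the infimum of the transport cost `∫ ‖ξ - ξ'‖ dπ(ξ, ξ')` over
all couplings `π` of `μ` and `ν`. -/
def W1 (μ ν : Measure (Lifted K)) : ℝ≥0∞ :=
  ⨅ (π : Measure (Lifted K × Lifted K)) (_ : π.fst = μ ∧ π.snd = ν), ∫⁻ p, ‖p.1 - p.2‖ₑ ∂π

namespace PEPData

variable (D : PEPData Θ K M) (θ : Θ) (ξhat : Fin N → Lifted K) (ε : ℝ)

/-! ### The Wasserstein problem (DRO-PEP) -/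

/-- The risk `E_Q[ℓ(G, F)]`. -/
def risk (Q : ProbabilityMeasure (Lifted K)) : ℝ := ∫ ξ, D.loss ξ ∂(Q : Measure (Lifted K))

/-- Probability distributions supported in `S^θ` at finite Wasserstein distance from the
empirical distribution (equivalently, with a finite first moment). -/
def finiteTransport : Set (ProbabilityMeasure (Lifted K)) :=
  {Q | (Q : Measure (Lifted K)).support ⊆ D.suppSet θ ∧ W1 (empirical ξhat) Q ≠ ⊤}

/-- The 1-Wasserstein ambiguity set of radius `ε`. -/
def ambiguitySet : Set (ProbabilityMeasure (Lifted K)) :=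
  {Q | (Q : Measure (Lifted K)).support ⊆ D.suppSet θ ∧
    W1 (empirical ξhat) Q ≤ ENNReal.ofReal ε}

/-- The optimal value of (DRO-PEP). -/
def droValue : EReal := ⨆ Q ∈ D.ambiguitySet θ ξhat ε, (D.risk Q : EReal)

/-! ### The finite-dimensional robust problem (DRO-PEP-P) -/

/-- Feasible points `ξ = (G_i, F_i)_i` of (DRO-PEP-P). -/
def primalFeasible : Set (Fin N → Lifted K) :=
  {ξ | (1 / (N : ℝ)) * ∑ i, ‖ξ i - ξhat i‖ ≤ ε ∧ ∀ i, ξ i ∈ D.suppSet θ}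

/-- The objective of (DRO-PEP-P). -/
def primalObj (ξ : Fin N → Lifted K) : ℝ := (1 / (N : ℝ)) * ∑ i, D.loss (ξ i)

/-- The optimal value of (DRO-PEP-P). -/
def primalValue : EReal := ⨆ ξ ∈ D.primalFeasible θ ξhat ε, (D.primalObj ξ : EReal)

end PEPData

/-! ### The conic problem (DRO-PEP-D) -/

/-- The optimization variables `(s_i, τ_i, (X_i, Y_i), y_i)_i` and `λ` of (DRO-PEP-D); the field
`X` holds the pairs `(X_i, Y_i)`. -/
structure DualVar (K M N : ℕ) where
  s : Fin N → ℝ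
  τ : Fin N → ℝ
  X : Fin N → Lifted K
  y : Fin N → Fin M → ℝ
  lam : ℝ

/-- The domain of the variables of (DRO-PEP-D): `τ_i ≥ 0`, `y_i ≥ 0`, `λ ≥ 0`. -/
def dualDomain (K M N : ℕ) : Set (DualVar K M N) :=
  {v | (∀ i, 0 ≤ v.τ i) ∧ (∀ i m, 0 ≤ v.y i m) ∧ 0 ≤ v.lam}

/-- The objective of (DRO-PEP-D). -/
def dualObj (v : DualVar K M N) : ℝ := (1 / (N : ℝ)) * ∑ i, v.s i

/-- The multipliers of the constraints of (DRO-PEP-D): for each `i`, `μ_i` for the scalar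
inequality, `Γ_i` for the constraint in `𝕊₊ × {0}`, and `(V_i, r_i)` for `‖(X_i, Y_i)‖_* ≤ λ`. -/
structure Multiplier (K N : ℕ) where
  μ : Fin N → ℝ
  Γ : Fin N → Lifted K
  V : Fin N → Lifted K
  r : Fin N → ℝ

/-- The product of the dual cones: `μ_i ≥ 0`, `Γ_i ∈ (𝕊₊ × {0})^* = 𝕊₊ × ℝ^(K+1)`, and
`(V_i, r_i)` in the dual `{‖V‖ ≤ r}` of the cone `{(X, λ) : ‖X‖_* ≤ λ}`. -/
def multiplierCone (K N : ℕ) : Set (Multiplier K N) :=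
  {w | (∀ i, 0 ≤ w.μ i) ∧ (∀ i, w.Γ i ∈ psdCone K) ∧ ∀ i, ‖w.V i‖ ≤ w.r i}

namespace PEPData

variable (D : PEPData Θ K M) (θ : Θ) (ξhat : Fin N → Lifted K) (ε : ℝ)

/-- `-𝓛^*(y) - (X, Y) + τ (A_0, b_0) - (A_obj, b_obj)`. -/
def conicSlack (X : Lifted K) (τ : ℝ) (y : Fin M → ℝ) : Lifted K :=
  -D.linAdj θ y - X + τ • D.init - D.obj

/-- Feasible points of (DRO-PEP-D). -/
def dualFeasible : Set (DualVar K M N) :=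
  {v | v ∈ dualDomain K M N ∧ ∀ i,
    -D.c₀ * v.τ i - pairing (v.X i) (ξhat i) + v.lam * ε ≤ v.s i ∧
    D.conicSlack θ (v.X i) (v.τ i) (v.y i) ∈ psdZeroCone K ∧
    dualNorm (v.X i) ≤ v.lam}

/-- The optimal value of (DRO-PEP-D). -/
def dualValue : EReal := ⨅ v ∈ D.dualFeasible θ ξhat ε, (dualObj v : EReal)

/-! ### Lagrangians -/

/-- The Lagrangian of (DRO-PEP) for the constraint `W₁ ≤ ε` with multiplier `lam`. -/
def droLagrangian (Q : ProbabilityMeasure (Lifted K)) (lam : ℝ) : ℝ :=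
  D.risk Q + lam * (ε - (W1 (empirical ξhat) Q).toReal)

/-- The value of the inner problem "maximize `ℓ(ξ) - λ ‖ξ - ξ̂‖` over `ξ ∈ S^θ`". -/
def innerValue (lam : ℝ) (ξ₀ : Lifted K) : EReal :=
  ⨆ ξ ∈ D.suppSet θ, ((D.loss ξ - lam * ‖ξ - ξ₀‖ : ℝ) : EReal)

/-- Feasible points `(ξ, ζ)` of the inner problem, written as "maximize `ℓ(ξ) - λ ‖ζ‖` subject to
`ζ = ξ - ξ̂`, `𝓛_θ(ξ) ≥ 0`, `Tr(A_0ᵀ G) + b_0ᵀ F + c_0 ≤ 0`" over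
`(ξ, ζ) ∈ (𝕊₊ × ℝ^(K+1)) × (𝕊 × ℝ^(K+1))`. -/
def innerFeasible (ξ₀ : Lifted K) : Set (Lifted K × Lifted K) :=
  {p | p.1 ∈ D.suppSet θ ∧ p.2 = p.1 - ξ₀}

/-- The Lagrangian of the inner problem; `X`, `y` and `τ` are the multipliers of the three
constraints. -/
def innerLagrangian (lam : ℝ) (ξ₀ : Lifted K) (p : Lifted K × Lifted K)
    (X : Lifted K) (τ : ℝ) (y : Fin M → ℝ) : ℝ :=
  D.loss p.1 - lam * ‖p.2‖ + pairing X (p.1 - ξ₀ - p.2) + ∑ m, y m * D.linMap θ p.1 m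
    - τ * D.initial p.1

/-- The dual function of the inner problem. -/
def innerDual (lam : ℝ) (ξ₀ : Lifted K) (X : Lifted K) (τ : ℝ) (y : Fin M → ℝ) : EReal :=
  ⨆ p ∈ psdCone K ×ˢ (Set.univ : Set (Lifted K)),
    (D.innerLagrangian θ lam ξ₀ p X τ y : EReal)

/-- The Lagrangian of (DRO-PEP-D). -/
def dualLagrangian (v : DualVar K M N) (w : Multiplier K N) : ℝ :=
  dualObj v
    + ∑ i, w.μ i * (-D.c₀ * v.τ i - pairing (v.X i) (ξhat i) + v.lam * ε - v.s i)
    - ∑ i, pairing (w.Γ i) (D.conicSlack θ (v.X i) (v.τ i) (v.y i))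
    - ∑ i, (pairing (w.V i) (v.X i) + w.r i * v.lam)

/-- (DRO-PEP-D) is a dual of (DRO-PEP):
* `droLagrangian` is a Lagrangian of (DRO-PEP) and its dual function is
  `λ ↦ λ ε + (1/N) ∑ᵢ innerValue λ ξ̂ᵢ`;
* `innerLagrangian` is a Lagrangian of the inner problem; replacing `innerValue` by the dual
  function of the inner problem and minimizing over the multipliers is (DRO-PEP-D), whose
  epigraph variables `s_i` are minimized out on the left-hand side. -/
def DualIsDualOfDRO : Prop :=
  (∀ Q ∈ D.finiteTransport θ ξhat,
    (⨅ lam ∈ Set.Ici (0 : ℝ), (D.droLagrangian ξhat ε Q lam : EReal)) =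
      ⨆ (_ : Q ∈ D.ambiguitySet θ ξhat ε), (D.risk Q : EReal)) ∧
  (∀ lam : ℝ, 0 ≤ lam →
    (⨆ Q ∈ D.finiteTransport θ ξhat, (D.droLagrangian ξhat ε Q lam : EReal)) =
      ((lam * ε : ℝ) : EReal)
        + ((1 / (N : ℝ) : ℝ) : EReal) * ∑ i, D.innerValue θ lam (ξhat i)) ∧
  (∀ lam : ℝ, 0 ≤ lam → ∀ i, ∀ p ∈ psdCone K ×ˢ (Set.univ : Set (Lifted K)),
    (⨅ (X : Lifted K) (τ : ℝ) (_ : 0 ≤ τ) (y : Fin M → ℝ) (_ : ∀ m, 0 ≤ y m),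
        (D.innerLagrangian θ lam (ξhat i) p X τ y : EReal)) =
      ⨆ (_ : p ∈ D.innerFeasible θ (ξhat i)), ((D.loss p.1 - lam * ‖p.2‖ : ℝ) : EReal)) ∧
  (∀ (lam : ℝ) (X : Fin N → Lifted K) (τ : Fin N → ℝ) (y : Fin N → Fin M → ℝ),
    0 ≤ lam → (∀ i, 0 ≤ τ i) → (∀ i m, 0 ≤ y i m) →
    (⨅ (s : Fin N → ℝ) (_ : (⟨s, τ, X, y, lam⟩ : DualVar K M N) ∈ D.dualFeasible θ ξhat ε),
        (dualObj (⟨s, τ, X, y, lam⟩ : DualVar K M N) : EReal)) =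
      ((lam * ε : ℝ) : EReal) + ((1 / (N : ℝ) : ℝ) : EReal) *
        ∑ i, D.innerDual θ lam (ξhat i) (X i) (τ i) (y i))

/-- (DRO-PEP-P) is the Lagrangian dual of (DRO-PEP-D):
* `dualLagrangian` is a Lagrangian of (DRO-PEP-D);
* with `Γ_i = (1/N) (G_i, F_i)`, the Lagrangian dual function, maximized over the remaining
  multipliers `μ, V, r`, is the objective of (DRO-PEP-P) on its feasible set and `-∞` elsewhere. -/
def PrimalIsDualOfDual : Prop :=
  (∀ v ∈ dualDomain K M N,
    (⨆ w ∈ multiplierCone K N, (D.dualLagrangian θ ξhat ε v w : EReal)) =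
      ⨅ (_ : v ∈ D.dualFeasible θ ξhat ε), (dualObj v : EReal)) ∧
  (∀ ξ : Fin N → Lifted K,
    (⨆ w ∈ {w ∈ multiplierCone K N | ∀ i, w.Γ i = (1 / (N : ℝ)) • ξ i},
        ⨅ v ∈ dualDomain K M N, (D.dualLagrangian θ ξhat ε v w : EReal)) =
      ⨆ (_ : ξ ∈ D.primalFeasible θ ξhat ε), (D.primalObj ξ : EReal))

end PEPData

end DROPEP

end

/-! The three values coincide by the cycle (DRO-PEP-P) ≤ (DRO-PEP) ≤ (DRO-PEP-D) ≤ (DRO-PEP-P).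

The first inequality is transport: a feasible tuple gives the uniform measure on its points, and
matching `ξhat i` with `ξ i` is a coupling whose cost is the averaged distance (`W1_meanDirac_le`).
The second is weak duality: a feasible point of (DRO-PEP-D) bounds `ℓ(ξ) - λ‖ξ - ξ̂ᵢ‖` on the
support set by a constant for each `i`, and this bound is integrated against a nearly optimal
coupling (`loss_sub_le_of_dualFeasible`, `risk_le`).

The third is strong duality with no Slater condition on the support set. Perturb all constraints and
the objective level of (DRO-PEP-P). The attainable perturbations form a convex set, and it is closed
because the transport budget confines the points to a bounded set. A level `p` above the optimal
value is therefore strictly separated from it, and the coefficients of the separating functional are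
the multipliers (`exists_multipliers`). The coefficient of the objective is positive because the
samples themselves are feasible.

The Lagrangian identities all follow one pattern: at a feasible point the bound is attained, and at
an infeasible one some ray of multipliers or variables drives the Lagrangian to `⊤` or `⊥`. What the
rays detect is exact because `𝕊₊ × {0}` and `𝕊₊ × ℝ^(K+1)` are dual cones (`mem_psdZeroCone_iff`)
and the norm is its own dual (`dualNorm_eq_norm`). -/

namespace DROPEP

/-- The pair `(v vᵀ, f)`. -/
noncomputable def rankOnePair {K : ℕ} (v : Fin (K + 2) → ℝ) (f : Fin (K + 1) → ℝ) : Lifted K :=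
  ⟨WithLp.toLp 2 (Sum.elim (fun p => v p.1 * v p.2) f), fun i j => mul_comm (v i) (v j)⟩

/-! ### Cone duality and the dual norm -/

section Cone

variable {K : ℕ}

theorem gram_rankOnePair (v : Fin (K + 2) → ℝ) (f : Fin (K + 1) → ℝ) :
    gram (rankOnePair v f) = Matrix.vecMulVec v v := rfl

theorem fval_rankOnePair (v : Fin (K + 2) → ℝ) (f : Fin (K + 1) → ℝ) :
    fval (rankOnePair v f) = f := rfl

theorem gram_isHermitian (ξ : Lifted K) : (gram ξ).IsHermitian :=
  Matrix.ext fun i j => ξ.2 j i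

theorem pairing_comm (a ξ : Lifted K) : pairing a ξ = pairing ξ a := by
  rw [pairing_eq_inner, pairing_eq_inner, real_inner_comm]

theorem pairing_add_left (a b ξ : Lifted K) : pairing (a + b) ξ = pairing a ξ + pairing b ξ := by
  simp only [pairing_eq_inner]; exact inner_add_left a b ξ

theorem pairing_sub_left (a b ξ : Lifted K) : pairing (a - b) ξ = pairing a ξ - pairing b ξ := by
  simp only [pairing_eq_inner]; exact inner_sub_left a b ξ

theorem pairing_smul_left (c : ℝ) (a ξ : Lifted K) : pairing (c • a) ξ = c * pairing a ξ := by
  simp only [pairing_eq_inner]; exact real_inner_smul_left a ξ c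

theorem pairing_sum_left {ι : Type*} (s : Finset ι) (a : ι → Lifted K) (ξ : Lifted K) :
    pairing (∑ i ∈ s, a i) ξ = ∑ i ∈ s, pairing (a i) ξ := by
  simp only [pairing_eq_inner]; exact sum_inner s a ξ

theorem pairing_zero_left (ξ : Lifted K) : pairing 0 ξ = 0 := by
  simp only [pairing_eq_inner]; exact inner_zero_left ξ

theorem pairing_add_right (a ξ η : Lifted K) : pairing a (ξ + η) = pairing a ξ + pairing a η := by
  simp only [pairing_comm a, pairing_add_left]

theorem pairing_sub_right (a ξ η : Lifted K) : pairing a (ξ - η) = pairing a ξ - pairing a η := by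
  simp only [pairing_comm a, pairing_sub_left]

theorem pairing_smul_right (c : ℝ) (a ξ : Lifted K) : pairing a (c • ξ) = c * pairing a ξ := by
  simp only [pairing_comm a, pairing_smul_left]

theorem pairing_zero_right (a : Lifted K) : pairing a 0 = 0 := by
  rw [pairing_comm, pairing_zero_left]

theorem pairing_self (a : Lifted K) : pairing a a = ‖a‖ ^ 2 := by
  rw [pairing_eq_inner]; exact real_inner_self_eq_norm_sq a

theorem abs_pairing_le (a ξ : Lifted K) : |pairing a ξ| ≤ ‖a‖ * ‖ξ‖ := by
  rw [pairing_eq_inner]; exact abs_real_inner_le_norm a ξ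

theorem continuous_pairing (a : Lifted K) : Continuous (pairing a) := by
  rw [funext (pairing_eq_inner a)]
  exact continuous_const.inner continuous_id

theorem pairing_rankOnePair (a : Lifted K) (v : Fin (K + 2) → ℝ) (f : Fin (K + 1) → ℝ) :
    pairing a (rankOnePair v f) = v ⬝ᵥ (gram a).mulVec v + fval a ⬝ᵥ f := by
  have h : (gram a).transpose = gram a := by
    simpa [Matrix.IsHermitian] using gram_isHermitian a
  rw [pairing, gram_rankOnePair, fval_rankOnePair, h, Matrix.mul_vecMulVec,
    Matrix.trace_vecMulVec, dotProduct_comm]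

theorem rankOnePair_mem_psdCone (v : Fin (K + 2) → ℝ) (f : Fin (K + 1) → ℝ) :
    rankOnePair v f ∈ psdCone K := by
  simpa [psdCone, gram_rankOnePair] using Matrix.posSemidef_vecMulVec_self_star v

/-- Membership becomes a family of linear inequalities, so closedness and stability under
nonnegative combinations need no matrix computation. -/
theorem mem_psdCone_iff {ξ : Lifted K} :
    ξ ∈ psdCone K ↔ ∀ v, 0 ≤ pairing ξ (rankOnePair v 0) := by
  simp only [pairing_rankOnePair, dotProduct_zero, add_zero]
  constructor
  · intro h v
    simpa using h.dotProduct_mulVec_nonneg v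
  · intro h
    exact Matrix.PosSemidef.of_dotProduct_mulVec_nonneg (gram_isHermitian ξ)
      fun v => by simpa using h v

theorem isClosed_psdCone : IsClosed (psdCone K) := by
  have : psdCone K = ⋂ v, {ξ | 0 ≤ pairing ξ (rankOnePair v 0)} := by
    ext ξ; simp [mem_psdCone_iff]
  rw [this]
  refine isClosed_iInter fun v => ?_
  simp only [pairing_comm _ (rankOnePair v 0)]
  exact isClosed_le continuous_const (continuous_pairing _)

theorem smul_add_smul_mem_psdCone {ξ η : Lifted K} (hξ : ξ ∈ psdCone K) (hη : η ∈ psdCone K)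
    {a b : ℝ} (ha : 0 ≤ a) (hb : 0 ≤ b) : a • ξ + b • η ∈ psdCone K := by
  rw [mem_psdCone_iff] at *
  intro v
  have h1 := hξ v
  have h2 := hη v
  rw [pairing_add_left, pairing_smul_left, pairing_smul_left]
  positivity

theorem smul_mem_psdCone {ξ : Lifted K} (hξ : ξ ∈ psdCone K) {a : ℝ} (ha : 0 ≤ a) :
    a • ξ ∈ psdCone K := by
  simpa using smul_add_smul_mem_psdCone hξ hξ ha le_rfl

theorem zero_mem_psdCone : (0 : Lifted K) ∈ psdCone K := by
  rw [mem_psdCone_iff]; simp [pairing_zero_left]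

-- With `C` the self-adjoint square root of `A`, one has `Tr(A G) = Tr(C G C)`, the trace of a
-- positive semidefinite matrix. The vector part of `a` vanishes, so that of `ξ` is free.
open scoped MatrixOrder in
theorem pairing_nonneg {a ξ : Lifted K} (ha : a ∈ psdZeroCone K) (hξ : ξ ∈ psdCone K) :
    0 ≤ pairing a ξ := by
  obtain ⟨ha, ha0⟩ := ha
  have h : (gram a).transpose = gram a := by
    simpa [Matrix.IsHermitian] using gram_isHermitian a
  obtain ⟨C, hC, -, hCC⟩ :=
    CFC.exists_sqrt_of_isSelfAdjoint_of_quasispectrumRestricts ha.isHermitian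
      (QuasispectrumRestricts.nnreal_of_nonneg ha.nonneg)
  rw [pairing, ha0, zero_dotProduct, add_zero, h, show gram a = C * C from hCC.symm, mul_assoc,
    Matrix.trace_mul_comm]
  nth_rw 2 [← hC.star_eq]
  exact (Matrix.PosSemidef.mul_mul_conjTranspose_same
    (show (gram ξ).PosSemidef from hξ) C).trace_nonneg

/-- The cone `𝕊₊ × {0}` is the dual of `𝕊₊ × ℝ^(K+1)`. -/
theorem mem_psdZeroCone_iff {a : Lifted K} :
    a ∈ psdZeroCone K ↔ ∀ ξ ∈ psdCone K, 0 ≤ pairing a ξ := by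
  refine ⟨fun h ξ hξ => pairing_nonneg h hξ, fun h =>
    ⟨mem_psdCone_iff.mpr fun v => h _ (rankOnePair_mem_psdCone v 0), ?_⟩⟩
  -- Testing on `(0, -b)`, where `b` is the vector part of `a`, gives `-b ⬝ᵥ b ≥ 0`, hence `b = 0`.
  have := h _ (rankOnePair_mem_psdCone 0 (-fval a))
  rw [pairing_rankOnePair, zero_dotProduct, zero_add, dotProduct_neg] at this
  exact dotProduct_self_eq_zero.mp (le_antisymm (by linarith)
    (by simpa using dotProduct_star_self_nonneg (fval a)))

/-- Cauchy–Schwarz gives the upper bound, and the normalized `X` attains it. -/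
theorem dualNorm_eq_norm (X : Lifted K) : dualNorm X = ‖X‖ := by
  refine IsLUB.csSup_eq ⟨?_, ?_⟩ ⟨_, 0, by simp, rfl⟩
  · rintro _ ⟨η, hη, rfl⟩
    exact ((le_abs_self _).trans (abs_pairing_le X η)).trans
      (mul_le_of_le_one_right (norm_nonneg X) hη)
  · intro b hb
    rcases eq_or_ne X 0 with rfl | hX
    · exact hb ⟨0, by simp, by simp [pairing_zero_left]⟩
    · refine hb ⟨‖X‖⁻¹ • X, ?_, ?_⟩
      · simp [norm_smul, hX]
      · rw [pairing_smul_right, pairing_self]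
        field_simp

end Cone

/-! ### Extended real optimal values -/

/-- Together with the next lemma, this settles the infeasible cases of the Lagrangian identities:
along a ray with parameter `t`, the Lagrangian is affine with slope `d`, the violation of a
constraint. -/
theorem eq_bot_of_forall_le {x : EReal} {c d : ℝ} (hd : d < 0)
    (h : ∀ t : ℝ, 0 ≤ t → x ≤ ((c + t * d : ℝ) : EReal)) : x = ⊥ := by
  rw [EReal.eq_bot_iff_forall_lt]
  intro r
  refine (h (max 0 ((r - 1 - c) / d)) (le_max_left _ _)).trans_lt ?_
  rw [EReal.coe_lt_coe_iff]
  have : max 0 ((r - 1 - c) / d) * d ≤ (r - 1 - c) / d * d :=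
    mul_le_mul_of_nonpos_right (le_max_right _ _) hd.le
  rw [div_mul_cancel₀ _ hd.ne] at this
  linarith

theorem eq_top_of_forall_le {x : EReal} {c d : ℝ} (hd : 0 < d)
    (h : ∀ t : ℝ, 0 ≤ t → ((c + t * d : ℝ) : EReal) ≤ x) : x = ⊤ := by
  rw [EReal.eq_top_iff_forall_lt]
  intro r
  refine lt_of_lt_of_le ?_ (h (max 0 ((r + 1 - c) / d)) (le_max_left _ _))
  rw [EReal.coe_lt_coe_iff]
  have : (r + 1 - c) / d * d ≤ max 0 ((r + 1 - c) / d) * d :=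
    mul_le_mul_of_nonneg_right (le_max_right _ _) hd.le
  rw [div_mul_cancel₀ _ hd.ne'] at this
  linarith

theorem EReal_sum_coe {ι : Type*} (s : Finset ι) (f : ι → ℝ) :
    ∑ i ∈ s, (f i : EReal) = ((∑ i ∈ s, f i : ℝ) : EReal) := by
  classical
  induction s using Finset.induction_on with
  | empty => simp
  | insert a s ha ih => rw [Finset.sum_insert ha, Finset.sum_insert ha, ih, EReal.coe_add]

theorem EReal_sum_ne_bot {ι : Type*} (s : Finset ι) {f : ι → EReal} (hf : ∀ i ∈ s, f i ≠ ⊥) :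
    ∑ i ∈ s, f i ≠ ⊥ := by
  classical
  induction s using Finset.induction_on with
  | empty => simp
  | insert a s ha ih =>
    rw [Finset.sum_insert ha]
    simp only [ne_eq, EReal.add_eq_bot_iff, not_or]
    exact ⟨hf a (by simp), ih fun i hi => hf i (by simp [hi])⟩

/-- The terms must avoid `⊥` because `⊤ + ⊥ = ⊥` in `EReal`. -/
theorem EReal_sum_eq_top {ι : Type*} [Fintype ι] {f : ι → EReal} (hf : ∀ i, f i ≠ ⊥) {i : ι}
    (hi : f i = ⊤) : ∑ i, f i = ⊤ := by
  classical
  rw [← Finset.add_sum_erase _ _ (Finset.mem_univ i), hi]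
  exact EReal.top_add_of_ne_bot (EReal_sum_ne_bot _ fun j _ => hf j)

/-- The affine combination `c + (1/N) ∑ᵢ xᵢ` is `⊤` as soon as some `xᵢ` is. -/
theorem coe_add_mean_eq_top {N : ℕ} (c : ℝ) {f : Fin N → EReal} (hf : ∀ i, f i ≠ ⊥) {i : Fin N}
    (hi : f i = ⊤) : (c : EReal) + ((1 / (N : ℝ) : ℝ) : EReal) * ∑ i, f i = ⊤ := by
  have hN : 0 < (N : ℝ) := Nat.cast_pos.mpr i.pos
  rw [EReal_sum_eq_top hf hi, EReal.coe_mul_top_of_pos (by positivity), EReal.coe_add_top]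

theorem coe_add_mean_coe {N : ℕ} (c : ℝ) (f : Fin N → ℝ) :
    (c : EReal) + ((1 / (N : ℝ) : ℝ) : EReal) * ∑ i, (f i : EReal) =
      ((c + 1 / (N : ℝ) * ∑ i, f i : ℝ) : EReal) := by
  rw [EReal_sum_coe, EReal.coe_add, EReal.coe_mul]

/-- The supremum of a separable sum is the sum of the suprema. -/
theorem iSup_coe_add_mean {N : ℕ} {α : Type*} (c : ℝ) (S : Fin N → Set α)
    (hS : ∀ i, (S i).Nonempty) (f : Fin N → α → ℝ) :
    (⨆ x ∈ {x : Fin N → α | ∀ i, x i ∈ S i}, ((c + 1 / (N : ℝ) * ∑ i, f i (x i) : ℝ) : EReal)) =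
      (c : EReal) + ((1 / (N : ℝ) : ℝ) : EReal) * ∑ i, ⨆ a ∈ S i, (f i a : EReal) := by
  choose x₀ hx₀ using hS
  have hbot : ∀ i, (⨆ a ∈ S i, (f i a : EReal)) ≠ ⊥ := fun i =>
    ne_bot_of_le_ne_bot (EReal.coe_ne_bot _) (le_iSup₂ (f := fun a _ => (f i a : EReal)) _ (hx₀ i))
  by_cases htop : ∃ i, (⨆ a ∈ S i, (f i a : EReal)) = ⊤
  · obtain ⟨i, hi⟩ := htop
    rw [coe_add_mean_eq_top c hbot hi, EReal.eq_top_iff_forall_lt]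
    intro r
    have hN : 0 < (N : ℝ) := Nat.cast_pos.mpr i.pos
    -- With the other coordinates frozen at `x₀`, this is the value the `i`-th term must exceed for
    -- the whole expression to exceed `r`.
    have hlt : (((r - c) * N - ∑ j ∈ Finset.univ.erase i, f j (x₀ j) : ℝ) : EReal) <
        ⨆ a ∈ S i, (f i a : EReal) := by rw [hi]; exact EReal.coe_lt_top _
    simp only [lt_iSup_iff, EReal.coe_lt_coe_iff] at hlt ⊢
    obtain ⟨a, ha, hlt⟩ := hlt
    refine ⟨Function.update x₀ i a, fun j => ?_, ?_⟩
    · rcases eq_or_ne j i with rfl | hj <;> simp [*]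
    · rw [← Finset.add_sum_erase _ _ (Finset.mem_univ i), Function.update_self,
        Finset.sum_congr rfl fun j hj => by rw [Function.update_of_ne (Finset.ne_of_mem_erase hj)]]
      have : r - c < 1 / (N : ℝ) * (f i a + ∑ j ∈ Finset.univ.erase i, f j (x₀ j)) := by
        rw [one_div, lt_inv_mul_iff₀ hN]; linarith
      linarith
  · push Not at htop
    have hs : ∀ i, ∃ s : ℝ, (⨆ a ∈ S i, (f i a : EReal)) = s := fun i =>
      ⟨_, (EReal.coe_toReal (htop i) (hbot i)).symm⟩
    choose s hs using hs
    simp only [hs, coe_add_mean_coe]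
    apply le_antisymm
    · refine iSup₂_le fun x hx => EReal.coe_le_coe_iff.mpr ?_
      gcongr with i
      exact EReal.coe_le_coe_iff.mp ((hs i).symm ▸
        le_iSup₂ (f := fun a _ => (f i a : EReal)) _ (hx i))
    · refine EReal.le_of_forall_lt_iff_le.mp fun z hz => ?_
      rw [EReal.coe_le_coe_iff]
      refine le_of_forall_pos_le_add fun η hη => ?_
      have hx : ∀ i, ∃ a ∈ S i, s i - η < f i a := fun i => by
        have : ((s i - η : ℝ) : EReal) < ⨆ a ∈ S i, (f i a : EReal) := by
          rw [hs, EReal.coe_lt_coe_iff]; linarith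
        simpa only [lt_iSup_iff, EReal.coe_lt_coe_iff, exists_prop] using this
      choose x hxS hx using hx
      have h1 := (le_iSup₂ (f := fun (x : Fin N → α) (_ : x ∈ {x : Fin N → α | ∀ i, x i ∈ S i}) =>
        ((c + 1 / (N : ℝ) * ∑ i, f i (x i) : ℝ) : EReal)) x hxS).trans_lt hz
      rw [EReal.coe_lt_coe_iff] at h1
      have h2 : 1 / (N : ℝ) * ∑ i, s i ≤ 1 / (N : ℝ) * ∑ i, (f i (x i) + η) := by
        gcongr with i; linarith [hx i]
      have h3 : 1 / (N : ℝ) * ∑ i, (f i (x i) + η) ≤ 1 / (N : ℝ) * ∑ i, f i (x i) + η := by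
        rcases Nat.eq_zero_or_pos N with rfl | hN
        · simp [hη.le]
        · have hN : 0 < (N : ℝ) := Nat.cast_pos.mpr hN
          rw [Finset.sum_add_distrib, mul_add]
          simp; field_simp; rfl
      linarith


/-! ### Transport from the empirical distribution -/

section Transport

variable {Θ : Type*} {K M N : ℕ}

theorem isProbabilityMeasure_mean {α : Type*} [MeasurableSpace α] [NeZero N] (x : Fin N → α) :
    IsProbabilityMeasure ((N : ℝ≥0∞)⁻¹ • ∑ i, Measure.dirac (x i)) :=
  ⟨by
    rw [Measure.smul_apply, Measure.finsetSum_apply]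
    simp [ENNReal.inv_mul_cancel, NeZero.ne N]⟩

theorem map_mean_dirac {α β : Type*} [MeasurableSpace α] [MeasurableSpace β] (x : Fin N → α)
    {g : α → β} (hg : Measurable g) :
    ((N : ℝ≥0∞)⁻¹ • ∑ i, Measure.dirac (x i)).map g =
      (N : ℝ≥0∞)⁻¹ • ∑ i, Measure.dirac (g (x i)) := by
  rw [Measure.map_smul, ← Measure.mapₗ_apply_of_measurable hg, map_sum]
  simp [Measure.mapₗ_apply_of_measurable, hg]

theorem integral_mean_dirac {α : Type*} [MeasurableSpace α] [MeasurableSingletonClass α]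
    [NeZero N] (x : Fin N → α) (f : α → ℝ) :
    ∫ a, f a ∂((N : ℝ≥0∞)⁻¹ • ∑ i, Measure.dirac (x i)) = 1 / (N : ℝ) * ∑ i, f (x i) := by
  rw [integral_smul_measure, integral_finsetSum_measure fun i _ => integrable_dirac (by simp)]
  simp

/-- A finite sum of Dirac masses makes every function measurable almost everywhere. This avoids
proving measurability of the supremum `H` in `risk_le_of_transport`. -/
theorem aestronglyMeasurable_empirical (ξhat : Fin N → Lifted K) (f : Lifted K → ℝ) :
    AEStronglyMeasurable f (empirical ξhat) := by
  refine AEStronglyMeasurable.mono_ac Measure.smul_absolutelyContinuous ?_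
  rw [← Measure.sum_fintype]
  exact AEStronglyMeasurable.sum_measure fun i => aestronglyMeasurable_dirac

theorem integrable_empirical [NeZero N] (ξhat : Fin N → Lifted K) (f : Lifted K → ℝ) :
    Integrable f (empirical ξhat) := by
  refine Integrable.smul_measure ?_ (by simp [NeZero.ne N])
  exact integrable_finsetSum_measure.mpr fun i _ => integrable_dirac (by simp)

theorem ae_empirical [NeZero N] (ξhat : Fin N → Lifted K) {p : Lifted K → Prop}
    (hp : ∀ i, p (ξhat i)) : ∀ᵐ a ∂empirical ξhat, p a := by
  refine Measure.ae_smul_measure ?_ _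
  rw [← Measure.sum_fintype, Measure.ae_sum_iff]
  intro i
  rw [ae_dirac_eq]
  exact hp i

theorem isProbabilityMeasure_of_fst [NeZero N] {ξhat : Fin N → Lifted K}
    {π : Measure (Lifted K × Lifted K)} (h : π.fst = empirical ξhat) : IsProbabilityMeasure π :=
  ⟨by rw [← Measure.fst_univ, h]; exact (isProbabilityMeasure_mean ξhat).measure_univ⟩

/-- The first coordinate is almost surely one of finitely many samples, hence bounded; the
difference of the coordinates is integrable by finiteness of the cost. -/
theorem integrable_snd_of_transport [NeZero N] {ξhat : Fin N → Lifted K}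
    {π : Measure (Lifted K × Lifted K)} (h : π.fst = empirical ξhat)
    (hfin : ∫⁻ p, ‖p.1 - p.2‖ₑ ∂π ≠ ⊤) : Integrable (fun p => p.2) π := by
  have := isProbabilityMeasure_of_fst h
  have h1 : Integrable (fun p : Lifted K × Lifted K => p.1 - p.2) π :=
    ⟨(measurable_fst.sub measurable_snd).aestronglyMeasurable, hfin.lt_top⟩
  have h2 : Integrable (fun p : Lifted K × Lifted K => p.1) π := by
    refine Integrable.of_bound measurable_fst.aestronglyMeasurable (∑ i, ‖ξhat i‖) ?_
    have : ∀ᵐ a ∂π.fst, ‖a‖ ≤ ∑ i, ‖ξhat i‖ := by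
      rw [h]
      exact ae_empirical ξhat fun i =>
        Finset.single_le_sum (f := fun i => ‖ξhat i‖) (fun _ _ => norm_nonneg _)
          (Finset.mem_univ i)
    exact ae_of_ae_map measurable_fst.aemeasurable this
  exact (h2.sub h1).congr (.of_forall fun p => sub_sub_cancel _ _)

variable (D : PEPData Θ K M) (θ : Θ)

theorem isClosed_suppSet : IsClosed (D.suppSet θ) := by
  refine isClosed_psdCone.inter (IsClosed.inter ?_ ?_)
  · simp only [PEPData.linMap]
    change IsClosed {ξ | ∀ m, 0 ≤ -pairing (D.lmi θ m) ξ}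
    rw [Set.ofPred_forall]
    exact isClosed_iInter fun m => isClosed_le continuous_const (continuous_pairing _).neg
  · exact isClosed_le ((continuous_pairing _).add continuous_const) continuous_const

theorem continuous_loss : Continuous D.loss := continuous_pairing D.obj

theorem integrable_loss {α : Type*} [MeasurableSpace α] {μ : Measure α} {X : α → Lifted K}
    (hX : Integrable X μ) : Integrable (fun a => D.loss (X a)) μ := by
  refine (hX.norm.const_mul ‖D.obj‖).mono'
    ((continuous_loss D).comp_aestronglyMeasurable hX.aestronglyMeasurable)
    (.of_forall fun a => abs_pairing_le _ _)

variable {D θ} {ξhat : Fin N → Lifted K}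

theorem exists_transport {Q : ProbabilityMeasure (Lifted K)} {c : ℝ≥0∞}
    (h : W1 (empirical ξhat) Q < c) : ∃ π : Measure (Lifted K × Lifted K),
      π.fst = empirical ξhat ∧ π.snd = Q ∧ ∫⁻ p, ‖p.1 - p.2‖ₑ ∂π < c := by
  simpa only [W1, iInf_lt_iff, exists_prop, and_assoc] using h

theorem integrable_loss_of_mem_finiteTransport [NeZero N] {Q : ProbabilityMeasure (Lifted K)}
    (hQ : Q ∈ D.finiteTransport θ ξhat) : Integrable D.loss (Q : Measure (Lifted K)) := by
  obtain ⟨π, h1, h2, h3⟩ := exists_transport hQ.2.lt_top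
  rw [← h2]
  exact (integrable_map_measure (continuous_loss D).aestronglyMeasurable
    measurable_snd.aemeasurable).mpr (integrable_loss D (integrable_snd_of_transport h1 h3.ne))

theorem risk_le_of_transport [NeZero N] {Q : ProbabilityMeasure (Lifted K)}
    (hQ : (Q : Measure (Lifted K)).support ⊆ D.suppSet θ)
    {π : Measure (Lifted K × Lifted K)} (hfst : π.fst = empirical ξhat) (hsnd : π.snd = Q)
    (hfin : ∫⁻ p, ‖p.1 - p.2‖ₑ ∂π ≠ ⊤) (lam : ℝ) {h : Fin N → ℝ}
    (hS : (D.suppSet θ).Nonempty)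
    (hh : ∀ i, ∀ ξ ∈ D.suppSet θ, D.loss ξ - lam * ‖ξ - ξhat i‖ ≤ h i) :
    D.risk Q ≤ lam * (∫⁻ p, ‖p.1 - p.2‖ₑ ∂π).toReal + 1 / (N : ℝ) * ∑ i, h i := by
  -- Samples may coincide, so `h i` need not be a function of the point `ξhat i`; `H` is one, and `H
  -- (ξhat i) ≤ h i`. Its values off the samples lie on a null set.
  let H : Lifted K → ℝ := fun a =>
    sSup ((fun ξ => D.loss ξ - lam * ‖ξ - a‖) '' D.suppSet θ)
  have hbdd : ∀ i, BddAbove ((fun ξ => D.loss ξ - lam * ‖ξ - ξhat i‖) '' D.suppSet θ) := fun i =>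
    ⟨h i, by rintro _ ⟨ξ, hξ, rfl⟩; exact hh i ξ hξ⟩
  have hmeas : Measurable fun p : Lifted K × Lifted K => p.1 - p.2 :=
    measurable_fst.sub measurable_snd
  have hHi : Integrable (fun p => H p.1) π := by
    have := integrable_empirical ξhat H
    rw [← hfst] at this
    exact this.comp_measurable measurable_fst
  have hH : ∫ p, H p.1 ∂π ≤ 1 / (N : ℝ) * ∑ i, h i := by
    have h1 : ∫ a, H a ∂π.fst = ∫ p, H p.1 ∂π :=
      integral_map measurable_fst.aemeasurable
        (hfst ▸ aestronglyMeasurable_empirical ξhat H : AEStronglyMeasurable H π.fst)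
    rw [← h1, hfst]
    refine (integral_mean_dirac ξhat H).trans_le ?_
    gcongr with i
    refine csSup_le (hS.image _) ?_
    rintro _ ⟨ξ, hξ, rfl⟩; exact hh i ξ hξ
  have hci : Integrable (fun p : Lifted K × Lifted K => ‖p.1 - p.2‖) π :=
    Integrable.norm ⟨hmeas.aestronglyMeasurable, hfin.lt_top⟩
  have hrisk : D.risk Q = ∫ p, D.loss p.2 ∂π := by
    rw [PEPData.risk, ← hsnd]
    exact integral_map measurable_snd.aemeasurable (continuous_loss D).aestronglyMeasurable
  have hae1 : ∀ᵐ p ∂π, ∃ i, p.1 = ξhat i := by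
    have : ∀ᵐ a ∂π.fst, ∃ i, a = ξhat i := by
      rw [hfst]; exact ae_empirical ξhat fun i => ⟨i, rfl⟩
    exact ae_of_ae_map measurable_fst.aemeasurable this
  have hae2 : ∀ᵐ p ∂π, p.2 ∈ D.suppSet θ := by
    have : ∀ᵐ a ∂π.snd, a ∈ D.suppSet θ := by
      rw [hsnd]; exact Filter.mem_of_superset Measure.support_mem_ae hQ
    exact ae_of_ae_map measurable_snd.aemeasurable this
  have hle : D.risk Q ≤ ∫ p, (lam * ‖p.1 - p.2‖ + H p.1) ∂π := by
    rw [hrisk]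
    refine integral_mono_ae (integrable_loss D (integrable_snd_of_transport hfst hfin))
      ((hci.const_mul lam).add hHi) ?_
    filter_upwards [hae1, hae2] with p hp1 hp2
    obtain ⟨i, hi⟩ := hp1
    have := le_csSup (hbdd i) ⟨p.2, hp2, rfl⟩
    simp only [H, hi]
    rw [norm_sub_rev]
    linarith
  rw [integral_add (hci.const_mul lam) hHi, integral_const_mul,
    integral_norm_eq_lintegral_enorm hmeas.aestronglyMeasurable] at hle
  linarith

theorem risk_le [NeZero N] {Q : ProbabilityMeasure (Lifted K)}
    (hQ : Q ∈ D.finiteTransport θ ξhat) {lam : ℝ} (hlam : 0 ≤ lam) {h : Fin N → ℝ}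
    (hS : (D.suppSet θ).Nonempty)
    (hh : ∀ i, ∀ ξ ∈ D.suppSet θ, D.loss ξ - lam * ‖ξ - ξhat i‖ ≤ h i) :
    D.risk Q ≤ lam * (W1 (empirical ξhat) Q).toReal + 1 / (N : ℝ) * ∑ i, h i := by
  refine le_of_forall_pos_le_add fun η hη => ?_
  -- An optimal coupling is not needed. An excess cost of `η / (lam + 1)` changes the bound by at
  -- most `η`, including when `lam = 0`.
  have hδ : 0 < η / (lam + 1) := by positivity
  obtain ⟨π, h1, h2, h3⟩ := exists_transport (ξhat := ξhat) (Q := Q)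
    (ENNReal.lt_add_right hQ.2 (ENNReal.ofReal_pos.mpr hδ).ne')
  have h4 := risk_le_of_transport hQ.1 h1 h2 h3.ne_top lam hS hh
  have h5 := ENNReal.toReal_mono (ENNReal.add_ne_top.mpr ⟨hQ.2, ENNReal.ofReal_ne_top⟩) h3.le
  rw [ENNReal.toReal_add hQ.2 ENNReal.ofReal_ne_top, ENNReal.toReal_ofReal hδ.le] at h5
  have h6 := mul_le_mul_of_nonneg_left h5 hlam
  have h7 : lam * (η / (lam + 1)) ≤ η := by
    rw [mul_div_assoc', div_le_iff₀ (by positivity)]; nlinarith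
  linarith

/-- The uniform distribution on the points of a finite family. -/
noncomputable def meanDirac [NeZero N] (ξ : Fin N → Lifted K) : ProbabilityMeasure (Lifted K) :=
  ⟨empirical ξ, isProbabilityMeasure_mean ξ⟩

theorem risk_meanDirac [NeZero N] (ξ : Fin N → Lifted K) :
    D.risk (meanDirac ξ) = D.primalObj ξ :=
  integral_mean_dirac ξ D.loss

theorem support_meanDirac [NeZero N] {ξ : Fin N → Lifted K} (hξ : ∀ i, ξ i ∈ D.suppSet θ) :
    (meanDirac ξ : Measure (Lifted K)).support ⊆ D.suppSet θ :=
  Measure.support_subset_of_isClosed (isClosed_suppSet D θ) (ae_empirical ξ hξ)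

/-- The coupling gives mass `1 / N` to each pair `(ξhat i, ξ i)`. -/
theorem W1_meanDirac_le [NeZero N] (ξhat ξ : Fin N → Lifted K) :
    W1 (empirical ξhat) (meanDirac ξ) ≤
      ENNReal.ofReal (1 / (N : ℝ) * ∑ i, ‖ξ i - ξhat i‖) := by
  refine (iInf₂_le ((N : ℝ≥0∞)⁻¹ • ∑ i, Measure.dirac (ξhat i, ξ i))
    (And.intro ?_ ?_)).trans_eq ?_
  · exact map_mean_dirac _ measurable_fst
  · exact map_mean_dirac _ measurable_snd
  · rw [lintegral_smul_measure, lintegral_finsetSum_measure,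
      ENNReal.ofReal_mul (by positivity), ENNReal.ofReal_sum_of_nonneg fun _ _ => norm_nonneg _]
    congr 1
    · rw [one_div, ENNReal.ofReal_inv_of_pos (Nat.cast_pos.mpr (NeZero.pos N)),
        ENNReal.ofReal_natCast]
    · refine Finset.sum_congr rfl fun i _ => ?_
      rw [lintegral_dirac, ofReal_norm, ← enorm_neg, neg_sub]

theorem meanDirac_mem_finiteTransport [NeZero N] {ξ : Fin N → Lifted K}
    (hξ : ∀ i, ξ i ∈ D.suppSet θ) : meanDirac ξ ∈ D.finiteTransport θ ξhat :=
  ⟨support_meanDirac hξ, ((W1_meanDirac_le ξhat ξ).trans_lt ENNReal.ofReal_lt_top).ne⟩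

/-- The dual function of (DRO-PEP). -/
theorem iSup_droLagrangian [NeZero N] (hξ : ∀ i, ξhat i ∈ D.suppSet θ) (ε : ℝ) {lam : ℝ}
    (hlam : 0 ≤ lam) :
    (⨆ Q ∈ D.finiteTransport θ ξhat, (D.droLagrangian ξhat ε Q lam : EReal)) =
      ((lam * ε : ℝ) : EReal)
        + ((1 / (N : ℝ) : ℝ) : EReal) * ∑ i, D.innerValue θ lam (ξhat i) := by
  have hbot : ∀ i, D.innerValue θ lam (ξhat i) ≠ ⊥ := fun i =>
    ne_bot_of_le_ne_bot (EReal.coe_ne_bot _) (le_iSup₂ (f := fun ξ _ =>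
      ((D.loss ξ - lam * ‖ξ - ξhat i‖ : ℝ) : EReal)) _ (hξ i))
  apply le_antisymm
  · by_cases htop : ∃ i, D.innerValue θ lam (ξhat i) = ⊤
    · obtain ⟨i, hi⟩ := htop
      rw [coe_add_mean_eq_top _ hbot hi]
      exact le_top
    · push Not at htop
      have hs : ∀ i, ∃ s : ℝ, D.innerValue θ lam (ξhat i) = s := fun i =>
        ⟨_, (EReal.coe_toReal (htop i) (hbot i)).symm⟩
      choose s hs using hs
      simp only [hs, coe_add_mean_coe]
      refine iSup₂_le fun Q hQ => EReal.coe_le_coe_iff.mpr ?_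
      have := risk_le hQ hlam ⟨_, hξ ⟨0, NeZero.pos N⟩⟩ (h := s) fun i ξ hξ =>
        EReal.coe_le_coe_iff.mp ((hs i).symm ▸ le_iSup₂ (f := fun ξ (_ : ξ ∈ D.suppSet θ) =>
          ((D.loss ξ - lam * ‖ξ - ξhat i‖ : ℝ) : EReal)) ξ hξ)
      rw [PEPData.droLagrangian]
      linarith
  -- Uniform measures on tuples suffice here: the distance enters the Lagrangian with a factor
  -- `-lam`, so its upper bound by the averaged cost has the right direction.
  · rw [show (∑ i, D.innerValue θ lam (ξhat i)) = ∑ i, ⨆ ξ ∈ D.suppSet θ,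
      ((D.loss ξ - lam * ‖ξ - ξhat i‖ : ℝ) : EReal) from rfl,
      ← iSup_coe_add_mean _ (fun _ => D.suppSet θ) fun i => ⟨_, hξ i⟩]
    refine iSup₂_le fun ξ hξ => ?_
    refine le_trans ?_ (le_iSup₂ (meanDirac ξ) (meanDirac_mem_finiteTransport hξ))
    rw [EReal.coe_le_coe_iff, PEPData.droLagrangian, risk_meanDirac, PEPData.primalObj,
      Finset.sum_sub_distrib, ← Finset.mul_sum]
    have := ENNReal.toReal_mono ENNReal.ofReal_ne_top (W1_meanDirac_le ξhat ξ)
    rw [ENNReal.toReal_ofReal (by positivity)] at this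
    have := mul_le_mul_of_nonneg_left this hlam
    linarith

theorem iInf_droLagrangian {Q : ProbabilityMeasure (Lifted K)} {ε : ℝ} (hε : 0 < ε)
    (hQ : Q ∈ D.finiteTransport θ ξhat) :
    (⨅ lam ∈ Set.Ici (0 : ℝ), (D.droLagrangian ξhat ε Q lam : EReal)) =
      ⨆ (_ : Q ∈ D.ambiguitySet θ ξhat ε), (D.risk Q : EReal) := by
  by_cases h : Q ∈ D.ambiguitySet θ ξhat ε
  · rw [iSup_pos h]
    apply le_antisymm
    · refine (iInf₂_le (0 : ℝ) Set.self_mem_Ici).trans_eq ?_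
      simp [PEPData.droLagrangian]
    · refine le_iInf₂ fun lam hlam => EReal.coe_le_coe_iff.mpr ?_
      have := ENNReal.toReal_le_of_le_ofReal hε.le h.2
      exact le_add_of_nonneg_right (mul_nonneg hlam (sub_nonneg.mpr this))
  · rw [iSup_neg h]
    refine eq_bot_of_forall_le (c := D.risk Q)
      (d := ε - (W1 (empirical ξhat) Q).toReal) ?_ fun t ht => iInf₂_le t ht
    have : ¬ W1 (empirical ξhat) Q ≤ ENNReal.ofReal ε := fun hW => h ⟨hQ.1, hW⟩
    rw [← ENNReal.ofReal_toReal hQ.2, ENNReal.ofReal_le_ofReal_iff hε.le] at this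
    linarith

theorem primalValue_le_droValue [NeZero N] (ε : ℝ) :
    D.primalValue θ ξhat ε ≤ D.droValue θ ξhat ε := by
  refine iSup₂_le fun ξ hξ => ?_
  refine le_trans ?_ (le_iSup₂ (f := fun Q _ => (D.risk Q : EReal)) (meanDirac ξ)
    ⟨support_meanDirac hξ.2, (W1_meanDirac_le ξhat ξ).trans (ENNReal.ofReal_le_ofReal hξ.1)⟩)
  rw [risk_meanDirac]

end Transport


/-! ### Lagrangian duals of the inner and the conic problems -/

section Lagrangian

variable {Θ : Type*} {K M N : ℕ} (D : PEPData Θ K M) (θ : Θ)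

theorem single_apply_nonneg {ι : Type*} [DecidableEq ι] (i : ι) {t : ℝ} (ht : 0 ≤ t) (j : ι) :
    0 ≤ Pi.single (M := fun _ => ℝ) i t j := by
  rw [Pi.single_apply]; split_ifs <;> simp [ht]

theorem pairing_conicSlack (X : Lifted K) (τ : ℝ) (y : Fin M → ℝ) (ξ : Lifted K) :
    pairing (D.conicSlack θ X τ y) ξ =
      -∑ m, y m * D.linMap θ ξ m - pairing X ξ + τ * pairing D.init ξ - D.loss ξ := by
  simp [PEPData.conicSlack, PEPData.linAdj, pairing_sub_left, pairing_add_left, pairing_smul_left,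
    pairing_sum_left, PEPData.linMap, PEPData.loss]

/-- Collecting terms by `ξ` and `ζ` decouples the supremum: the `ξ` part is bounded on the cone
exactly under the conic constraint, the `ζ` part exactly under the norm constraint. -/
theorem innerLagrangian_eq (lam : ℝ) (ξ₀ : Lifted K) (p : Lifted K × Lifted K)
    (X : Lifted K) (τ : ℝ) (y : Fin M → ℝ) :
    D.innerLagrangian θ lam ξ₀ p X τ y =
      -D.c₀ * τ - pairing X ξ₀ - pairing (D.conicSlack θ X τ y) p.1
        - (lam * ‖p.2‖ + pairing X p.2) := by
  rw [pairing_conicSlack, PEPData.innerLagrangian, pairing_sub_right, pairing_sub_right,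
    PEPData.initial]
  ring

theorem coe_le_innerDual {lam : ℝ} {ξ₀ : Lifted K} {X : Lifted K} {τ : ℝ} {y : Fin M → ℝ}
    {p : Lifted K × Lifted K} (hp : p.1 ∈ psdCone K) :
    (D.innerLagrangian θ lam ξ₀ p X τ y : EReal) ≤ D.innerDual θ lam ξ₀ X τ y :=
  le_iSup₂ (f := fun p _ => (D.innerLagrangian θ lam ξ₀ p X τ y : EReal)) p ⟨hp, trivial⟩

theorem innerDual_of_feasible {lam : ℝ} (ξ₀ : Lifted K) {X : Lifted K} {τ : ℝ} {y : Fin M → ℝ}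
    (h : D.conicSlack θ X τ y ∈ psdZeroCone K) (hX : dualNorm X ≤ lam) :
    D.innerDual θ lam ξ₀ X τ y = ((-D.c₀ * τ - pairing X ξ₀ : ℝ) : EReal) := by
  rw [dualNorm_eq_norm] at hX
  apply le_antisymm
  · refine iSup₂_le fun p hp => EReal.coe_le_coe_iff.mpr ?_
    rw [innerLagrangian_eq]
    have h1 := pairing_nonneg h hp.1
    have h2 := (abs_le.mp (abs_pairing_le X p.2)).1
    have h3 := mul_le_mul_of_nonneg_right hX (norm_nonneg p.2)
    linarith
  · refine le_trans (EReal.coe_le_coe_iff.mpr ?_)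
      (coe_le_innerDual D θ (p := (0, 0)) zero_mem_psdCone)
    rw [innerLagrangian_eq]
    simp [pairing_zero_right]

theorem innerDual_of_not_feasible {lam : ℝ} (hlam : 0 ≤ lam) (ξ₀ : Lifted K) {X : Lifted K}
    {τ : ℝ} {y : Fin M → ℝ}
    (h : ¬ (D.conicSlack θ X τ y ∈ psdZeroCone K ∧ dualNorm X ≤ lam)) :
    D.innerDual θ lam ξ₀ X τ y = ⊤ := by
  rw [dualNorm_eq_norm, not_and_or, mem_psdZeroCone_iff] at h
  push Not at h
  rcases h with ⟨ξ, hξ, hneg⟩ | h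
  · refine eq_top_of_forall_le (c := -D.c₀ * τ - pairing X ξ₀) (neg_pos.mpr hneg) fun t ht =>
      le_trans (EReal.coe_le_coe_iff.mpr ?_)
        (coe_le_innerDual D θ (p := (t • ξ, 0)) (smul_mem_psdCone hξ ht))
    simp only [innerLagrangian_eq, pairing_smul_right, pairing_zero_right, norm_zero]
    linarith
  -- Along `ζ = -t X` the Lagrangian has slope `‖X‖ (‖X‖ - λ) > 0`.
  · have hX : 0 < ‖X‖ := hlam.trans_lt h
    refine eq_top_of_forall_le (c := -D.c₀ * τ - pairing X ξ₀)
      (mul_pos hX (sub_pos.mpr h)) fun t ht =>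
      le_trans (EReal.coe_le_coe_iff.mpr ?_)
        (coe_le_innerDual D θ (p := (0, (-t) • X)) zero_mem_psdCone)
    simp only [innerLagrangian_eq, pairing_smul_right, pairing_zero_right, pairing_self]
    rw [show ‖(-t) • X‖ = t * ‖X‖ by rw [norm_smul, norm_neg, Real.norm_of_nonneg ht]]
    linarith

theorem innerDual_ne_bot (lam : ℝ) (ξ₀ X : Lifted K) (τ : ℝ) (y : Fin M → ℝ) :
    D.innerDual θ lam ξ₀ X τ y ≠ ⊥ :=
  ne_bot_of_le_ne_bot (EReal.coe_ne_bot _)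
    (coe_le_innerDual D θ (p := (0, 0)) zero_mem_psdCone)

/-- Minimizing (DRO-PEP-D) over the epigraph variables gives the inner dual functions. -/
theorem iInf_dualObj (hN : 0 < N) (ξhat : Fin N → Lifted K) (ε : ℝ) {lam : ℝ}
    (X : Fin N → Lifted K) {τ : Fin N → ℝ} {y : Fin N → Fin M → ℝ}
    (hlam : 0 ≤ lam) (hτ : ∀ i, 0 ≤ τ i) (hy : ∀ i m, 0 ≤ y i m) :
    (⨅ (s : Fin N → ℝ) (_ : (⟨s, τ, X, y, lam⟩ : DualVar K M N) ∈ D.dualFeasible θ ξhat ε),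
        (dualObj (⟨s, τ, X, y, lam⟩ : DualVar K M N) : EReal)) =
      ((lam * ε : ℝ) : EReal) + ((1 / (N : ℝ) : ℝ) : EReal) *
        ∑ i, D.innerDual θ lam (ξhat i) (X i) (τ i) (y i) := by
  by_cases h : ∀ i, D.conicSlack θ (X i) (τ i) (y i) ∈ psdZeroCone K ∧ dualNorm (X i) ≤ lam
  · rw [Finset.sum_congr rfl fun i _ =>
      innerDual_of_feasible D θ (ξhat i) (h i).1 (h i).2, coe_add_mean_coe]
    have hN' : (N : ℝ) ≠ 0 := (Nat.cast_pos.mpr hN).ne'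
    have hsum : lam * ε + 1 / (N : ℝ) * ∑ i, (-D.c₀ * τ i - pairing (X i) (ξhat i)) =
        1 / (N : ℝ) * ∑ i, (-D.c₀ * τ i - pairing (X i) (ξhat i) + lam * ε) := by
      rw [Finset.sum_add_distrib (g := fun _ => lam * ε)]
      simp
      field_simp
      ring
    rw [hsum]
    apply le_antisymm
    · exact iInf₂_le (f := fun s (_ : (⟨s, τ, X, y, lam⟩ : DualVar K M N) ∈
        D.dualFeasible θ ξhat ε) => (dualObj (⟨s, τ, X, y, lam⟩ : DualVar K M N) : EReal))
        (fun i => -D.c₀ * τ i - pairing (X i) (ξhat i) + lam * ε)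
        ⟨⟨hτ, hy, hlam⟩, fun i => ⟨le_rfl, h i⟩⟩
    · refine le_iInf₂ fun s hs => EReal.coe_le_coe_iff.mpr ?_
      rw [dualObj]
      gcongr with i
      exact (hs.2 i).1
  · push Not at h
    obtain ⟨i, hi⟩ := h
    rw [coe_add_mean_eq_top _ (fun i => innerDual_ne_bot D θ _ _ _ _ _)
      (innerDual_of_not_feasible D θ hlam (ξhat i) fun hc => (hi hc.1).not_ge hc.2)]
    exact iInf₂_eq_top.mpr fun s hs => absurd (hs.2 i).2.2 (hi (hs.2 i).2.1).not_ge

theorem iInf_innerLagrangian (lam : ℝ) (ξ₀ : Lifted K) {p : Lifted K × Lifted K}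
    (hp : p.1 ∈ psdCone K) :
    (⨅ (X : Lifted K) (τ : ℝ) (_ : 0 ≤ τ) (y : Fin M → ℝ) (_ : ∀ m, 0 ≤ y m),
        (D.innerLagrangian θ lam ξ₀ p X τ y : EReal)) =
      ⨆ (_ : p ∈ D.innerFeasible θ ξ₀), ((D.loss p.1 - lam * ‖p.2‖ : ℝ) : EReal) := by
  have hle : ∀ (X : Lifted K) (τ : ℝ) (_ : 0 ≤ τ) (y : Fin M → ℝ) (_ : ∀ m, 0 ≤ y m),
      (⨅ (X : Lifted K) (τ : ℝ) (_ : 0 ≤ τ) (y : Fin M → ℝ) (_ : ∀ m, 0 ≤ y m),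
        (D.innerLagrangian θ lam ξ₀ p X τ y : EReal)) ≤ D.innerLagrangian θ lam ξ₀ p X τ y :=
    fun X τ hτ y hy => iInf_le_of_le X (iInf_le_of_le τ (iInf_le_of_le hτ
      (iInf_le_of_le y (iInf_le_of_le hy le_rfl))))
  by_cases h : p ∈ D.innerFeasible θ ξ₀
  · rw [iSup_pos h]
    obtain ⟨⟨-, hL, h0⟩, hζ⟩ := h
    apply le_antisymm
    · refine (hle 0 0 le_rfl 0 fun _ => le_rfl).trans_eq ?_
      simp [PEPData.innerLagrangian, pairing_zero_left]
    · refine le_iInf fun X => le_iInf₂ fun τ hτ => le_iInf₂ fun y hy =>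
        EReal.coe_le_coe_iff.mpr ?_
      have h1 : p.1 - ξ₀ - p.2 = 0 := by rw [hζ, sub_self]
      have h2 : 0 ≤ ∑ m, y m * D.linMap θ p.1 m :=
        Finset.sum_nonneg fun m _ => mul_nonneg (hy m) (hL m)
      have h3 := mul_nonneg_of_nonpos_of_nonpos (neg_nonpos.mpr hτ) h0
      rw [PEPData.innerLagrangian, h1, pairing_zero_right]
      linarith
  · rw [iSup_neg h]
    by_cases hζ : p.2 = p.1 - ξ₀
    · by_cases hL : ∀ m, 0 ≤ D.linMap θ p.1 m
      · have h0 : 0 < D.initial p.1 := by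
          by_contra h0
          exact h ⟨⟨hp, hL, not_lt.mp h0⟩, hζ⟩
        refine eq_bot_of_forall_le (c := D.loss p.1 - lam * ‖p.2‖) (neg_neg_of_pos h0)
          fun t ht => (hle 0 t ht 0 fun _ => le_rfl).trans (EReal.coe_le_coe_iff.mpr ?_)
        simp [PEPData.innerLagrangian, pairing_zero_left, sub_eq_add_neg]
      · push Not at hL
        obtain ⟨m, hm⟩ := hL
        refine eq_bot_of_forall_le (c := D.loss p.1 - lam * ‖p.2‖) hm
          fun t ht => (hle 0 0 le_rfl (Pi.single m t) (single_apply_nonneg m ht)).trans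
            (EReal.coe_le_coe_iff.mpr ?_)
        simp [PEPData.innerLagrangian, pairing_zero_left, Pi.single_apply]
    -- The multiplier `-t` times the residual of the equality constraint contributes `-t` times its
    -- squared norm.
    · have hd : 0 < ‖p.1 - ξ₀ - p.2‖ := norm_pos_iff.mpr fun hc => hζ (sub_eq_zero.mp hc).symm
      refine eq_bot_of_forall_le (c := D.loss p.1 - lam * ‖p.2‖)
        (neg_neg_of_pos (pow_pos hd 2)) fun t ht =>
        (hle ((-t) • (p.1 - ξ₀ - p.2)) 0 le_rfl 0 fun _ => le_rfl).trans
          (EReal.coe_le_coe_iff.mpr ?_)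
      simp only [PEPData.innerLagrangian, pairing_smul_left, pairing_self, Pi.zero_apply, zero_mul,
        Finset.sum_const_zero]
      linarith

variable (ξhat : Fin N → Lifted K) (ε : ℝ)

theorem iSup_dualLagrangian {v : DualVar K M N} (hv : v ∈ dualDomain K M N) :
    (⨆ w ∈ multiplierCone K N, (D.dualLagrangian θ ξhat ε v w : EReal)) =
      ⨅ (_ : v ∈ D.dualFeasible θ ξhat ε), (dualObj v : EReal) := by
  have hle : ∀ w ∈ multiplierCone K N, (D.dualLagrangian θ ξhat ε v w : EReal) ≤
      ⨆ w ∈ multiplierCone K N, (D.dualLagrangian θ ξhat ε v w : EReal) := fun w hw =>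
    le_iSup₂ (f := fun w _ => (D.dualLagrangian θ ξhat ε v w : EReal)) w hw
  by_cases h : v ∈ D.dualFeasible θ ξhat ε
  · rw [iInf_pos h]
    apply le_antisymm
    · refine iSup₂_le fun w hw => EReal.coe_le_coe_iff.mpr ?_
      have h1 : ∑ i, w.μ i * (-D.c₀ * v.τ i - pairing (v.X i) (ξhat i) + v.lam * ε - v.s i) ≤ 0 :=
        Finset.sum_nonpos fun i _ => mul_nonpos_of_nonneg_of_nonpos (hw.1 i)
          (sub_nonpos.mpr (h.2 i).1)
      have h2 : 0 ≤ ∑ i, pairing (w.Γ i) (D.conicSlack θ (v.X i) (v.τ i) (v.y i)) :=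
        Finset.sum_nonneg fun i _ => by
          rw [pairing_comm]; exact pairing_nonneg (h.2 i).2.1 (hw.2.1 i)
      have h3 : 0 ≤ ∑ i, (pairing (w.V i) (v.X i) + w.r i * v.lam) :=
        Finset.sum_nonneg fun i _ => by
          have h4 := (h.2 i).2.2
          rw [dualNorm_eq_norm] at h4
          have h5 := (abs_le.mp (abs_pairing_le (w.V i) (v.X i))).1
          have h6 := mul_le_mul (hw.2.2 i) h4 (norm_nonneg _)
            ((norm_nonneg _).trans (hw.2.2 i))
          linarith
      rw [PEPData.dualLagrangian]
      linarith
    · refine le_trans (EReal.coe_le_coe_iff.mpr ?_) (hle ⟨0, 0, 0, 0⟩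
        ⟨fun _ => le_rfl, fun _ => zero_mem_psdCone, fun i => by simp⟩)
      simp [PEPData.dualLagrangian, pairing_zero_left]
  · rw [iInf_neg h]
    have hex : ∃ i, ¬ (-D.c₀ * v.τ i - pairing (v.X i) (ξhat i) + v.lam * ε ≤ v.s i ∧
        D.conicSlack θ (v.X i) (v.τ i) (v.y i) ∈ psdZeroCone K ∧ dualNorm (v.X i) ≤ v.lam) := by
      by_contra hc
      push Not at hc
      exact h ⟨hv, hc⟩
    obtain ⟨i, hi⟩ := hex
    rw [not_and_or, not_and_or, not_le, mem_psdZeroCone_iff, dualNorm_eq_norm, not_le] at hi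
    push Not at hi
    rcases hi with hi | ⟨Γ, hΓ, hi⟩ | hi
    · refine eq_top_of_forall_le (c := dualObj v) (sub_pos.mpr hi) fun t ht =>
        le_trans (EReal.coe_le_coe_iff.mpr ?_) (hle ⟨Pi.single i t, 0, 0, 0⟩
        ⟨single_apply_nonneg i ht, fun _ => zero_mem_psdCone, fun i => by simp⟩)
      simp [PEPData.dualLagrangian, pairing_zero_left, Pi.single_apply]
    · refine eq_top_of_forall_le (c := dualObj v) (neg_pos.mpr hi) fun t ht =>
        le_trans (EReal.coe_le_coe_iff.mpr ?_)
          (hle ⟨0, fun j => (if j = i then t else 0) • Γ, 0, 0⟩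
        ⟨fun _ => le_rfl, fun j => smul_mem_psdCone hΓ (by split_ifs <;> simp [ht]),
          fun i => by simp⟩)
      simp only [PEPData.dualLagrangian, pairing_smul_left, pairing_comm Γ]
      simp [pairing_zero_left]
    -- The ray `V = -t X_i`, `r = t ‖X_i‖` on the boundary of the multiplier cone has slope `‖X_i‖
    -- (‖X_i‖ - λ) > 0`.
    · have hX : 0 < ‖v.X i‖ := hv.2.2.trans_lt hi
      refine eq_top_of_forall_le (c := dualObj v) (mul_pos hX (sub_pos.mpr hi)) fun t ht =>
        le_trans (EReal.coe_le_coe_iff.mpr ?_)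
          (hle ⟨0, 0, fun j => (if j = i then -t else 0) • v.X i,
            fun j => if j = i then t * ‖v.X i‖ else 0⟩
        ⟨fun _ => le_rfl, fun _ => zero_mem_psdCone, fun j => ?_⟩)
      · simp only [PEPData.dualLagrangian, pairing_smul_left, Finset.sum_add_distrib, ite_mul,
          Finset.sum_ite_eq', Finset.mem_univ, if_true, pairing_self, zero_mul, Pi.zero_apply,
          pairing_zero_left, Finset.sum_const_zero]
        linarith
      · change ‖(if j = i then -t else 0) • v.X i‖ ≤ if j = i then t * ‖v.X i‖ else 0
        rw [norm_smul]
        split_ifs <;> simp [abs_of_nonneg ht]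

/-- The part of the Lagrangian of (DRO-PEP-D) that is linear in the variables of (DRO-PEP-D). -/
noncomputable def dualLagrangianLin (v : DualVar K M N) (w : Multiplier K N) : ℝ :=
  ∑ i, (1 / (N : ℝ) - w.μ i) * v.s i
    + ∑ i, (-D.c₀ * w.μ i - pairing D.init (w.Γ i)) * v.τ i
    + ∑ i, pairing (w.Γ i - w.μ i • ξhat i - w.V i) (v.X i)
    + ∑ i, ∑ m, D.linMap θ (w.Γ i) m * v.y i m
    + v.lam * (ε * ∑ i, w.μ i - ∑ i, w.r i)

theorem dualLagrangian_eq (v : DualVar K M N) (w : Multiplier K N) :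
    D.dualLagrangian θ ξhat ε v w =
      ∑ i, D.loss (w.Γ i) + dualLagrangianLin D θ ξhat ε v w := by
  have h : ∀ i, pairing (w.Γ i) (D.conicSlack θ (v.X i) (v.τ i) (v.y i)) =
      -∑ m, D.linMap θ (w.Γ i) m * v.y i m - pairing (w.Γ i) (v.X i)
        + v.τ i * pairing D.init (w.Γ i) - D.loss (w.Γ i) := fun i => by
    rw [pairing_comm, pairing_conicSlack, pairing_comm (v.X i)]
    simp only [mul_comm (v.y i _)]
  simp only [PEPData.dualLagrangian, dualLagrangianLin, dualObj, h, pairing_sub_left,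
    pairing_smul_left, Finset.mul_sum, ← Finset.sum_add_distrib, ← Finset.sum_sub_distrib,
    pairing_comm (v.X _)]
  refine Finset.sum_congr rfl fun i _ => ?_
  ring

theorem dualLagrangianLin_smul (t : ℝ) (v : DualVar K M N) (w : Multiplier K N) :
    dualLagrangianLin D θ ξhat ε
        ⟨t • v.s, t • v.τ, fun i => t • v.X i, fun i => t • v.y i, t * v.lam⟩ w =
      t * dualLagrangianLin D θ ξhat ε v w := by
  simp only [dualLagrangianLin]
  rw [mul_add, mul_add, mul_add, mul_add]
  refine congrArg₂ _ (congrArg₂ _ (congrArg₂ _ (congrArg₂ _ ?_ ?_) ?_) ?_) (mul_assoc _ _ _)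
  · rw [Finset.mul_sum]
    exact Finset.sum_congr rfl fun i _ => mul_left_comm _ _ _
  · rw [Finset.mul_sum]
    exact Finset.sum_congr rfl fun i _ => mul_left_comm _ _ _
  · rw [Finset.mul_sum]
    exact Finset.sum_congr rfl fun i _ => pairing_smul_right _ _ _
  · simp_rw [Finset.mul_sum]
    exact Finset.sum_congr rfl fun i _ => Finset.sum_congr rfl fun m _ => mul_left_comm _ _ _

theorem linMap_smul (c : ℝ) (ξ : Lifted K) (m : Fin M) :
    D.linMap θ (c • ξ) m = c * D.linMap θ ξ m := by
  simp [PEPData.linMap, pairing_smul_right]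

/-- The infimum is finite only if the linear part is nonnegative on the cone of variables. The free
variables `s` and `X` force `μ_i = 1/N` and `V_i = (ξ_i - ξ̂_i)/N`; the signed ones give the
constraints of `suppSet`; and `λ`, with `‖V_i‖ ≤ r_i`, gives the transport budget. -/
theorem iSup_iInf_dualLagrangian (hN : 0 < N) (ξ : Fin N → Lifted K) :
    (⨆ w ∈ {w ∈ multiplierCone K N | ∀ i, w.Γ i = (1 / (N : ℝ)) • ξ i},
        ⨅ v ∈ dualDomain K M N, (D.dualLagrangian θ ξhat ε v w : EReal)) =
      ⨆ (_ : ξ ∈ D.primalFeasible θ ξhat ε), (D.primalObj ξ : EReal) := by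
  have hN' : 0 < 1 / (N : ℝ) := by positivity
  have hloss : ∀ w : Multiplier K N, (∀ i, w.Γ i = (1 / (N : ℝ)) • ξ i) →
      ∑ i, D.loss (w.Γ i) = D.primalObj ξ := fun w hw => by
    simp only [hw, PEPData.loss, pairing_smul_right, PEPData.primalObj, Finset.mul_sum]
  have h0 : (⟨0, 0, 0, 0, 0⟩ : DualVar K M N) ∈ dualDomain K M N :=
    ⟨fun _ => le_rfl, fun _ _ => le_rfl, le_rfl⟩
  by_cases hξ : ξ ∈ D.primalFeasible θ ξhat ε
  · rw [iSup_pos hξ]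
    apply le_antisymm
    · refine iSup₂_le fun w hw => (iInf₂_le _ h0).trans_eq ?_
      rw [dualLagrangian_eq, hloss w hw.2]
      simp [dualLagrangianLin, pairing_zero_right]
    · let w : Multiplier K N := ⟨fun _ => 1 / (N : ℝ), fun i => (1 / (N : ℝ)) • ξ i,
        fun i => (1 / (N : ℝ)) • (ξ i - ξhat i), fun i => 1 / (N : ℝ) * ‖ξ i - ξhat i‖⟩
      have hw : w ∈ {w ∈ multiplierCone K N | ∀ i, w.Γ i = (1 / (N : ℝ)) • ξ i} :=
        ⟨⟨fun _ => hN'.le, fun i => smul_mem_psdCone (hξ.2 i).1 hN'.le, fun i => by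
          change ‖(1 / (N : ℝ)) • (ξ i - ξhat i)‖ ≤ _
          rw [norm_smul, Real.norm_of_nonneg hN'.le]⟩, fun _ => rfl⟩
      refine le_trans (le_iInf₂ fun v hv => EReal.coe_le_coe_iff.mpr ?_) (le_iSup₂ (f := fun w
        (_ : w ∈ {w ∈ multiplierCone K N | ∀ i, w.Γ i = (1 / (N : ℝ)) • ξ i}) =>
        ⨅ v ∈ dualDomain K M N, (D.dualLagrangian θ ξhat ε v w : EReal)) w hw)
      rw [dualLagrangian_eq, hloss w fun _ => rfl]
      refine le_add_of_nonneg_right ?_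
      have e1 : ∑ i, (1 / (N : ℝ) - w.μ i) * v.s i = 0 := by simp [w]
      have e2 : ∑ i, pairing (w.Γ i - w.μ i • ξhat i - w.V i) (v.X i) = 0 :=
        Finset.sum_eq_zero fun i _ => by
          simp [w, pairing_sub_left, pairing_smul_left]; ring
      have e3 : 0 ≤ ∑ i, (-D.c₀ * w.μ i - pairing D.init (w.Γ i)) * v.τ i :=
        Finset.sum_nonneg fun i _ => mul_nonneg (by
          have := mul_nonneg hN'.le (neg_nonneg.mpr (hξ.2 i).2.2)
          simp only [w, pairing_smul_right]
          rw [PEPData.initial] at this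
          linarith) (hv.1 i)
      have e4 : 0 ≤ ∑ i, ∑ m, D.linMap θ (w.Γ i) m * v.y i m :=
        Finset.sum_nonneg fun i _ => Finset.sum_nonneg fun m _ => mul_nonneg (by
          simp only [w, linMap_smul]
          exact mul_nonneg hN'.le ((hξ.2 i).2.1 m)) (hv.2.1 i m)
      have e5 : 0 ≤ v.lam * (ε * ∑ i, w.μ i - ∑ i, w.r i) := by
        refine mul_nonneg hv.2.2 (sub_nonneg.mpr ?_)
        have : ∑ i, w.μ i = 1 := by simp [w]; field_simp
        rw [this, mul_one, ← Finset.mul_sum]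
        exact hξ.1
      rw [dualLagrangianLin, e1, e2]
      linarith
  · rw [iSup_neg hξ]
    refine iSup₂_eq_bot.mpr fun w hw => ?_
    by_contra hne
    -- The domain is a cone and the linear part is homogeneous, so one negative value would scale to
    -- `⊥`.
    have hlin : ∀ v ∈ dualDomain K M N, 0 ≤ dualLagrangianLin D θ ξhat ε v w := fun v hv => by
      by_contra hc
      refine hne (eq_bot_of_forall_le (c := D.primalObj ξ) (not_le.mp hc) fun t ht => ?_)
      rw [← dualLagrangianLin_smul, ← hloss w hw.2, ← dualLagrangian_eq]
      exact iInf₂_le _ ⟨fun i => mul_nonneg ht (hv.1 i), fun i m => mul_nonneg ht (hv.2.1 i m),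
        mul_nonneg ht hv.2.2⟩
    have hμ : ∀ i, w.μ i = 1 / (N : ℝ) := fun i => by
      have h1 := hlin ⟨Pi.single i 1, 0, 0, 0, 0⟩ ⟨fun _ => le_rfl, fun _ _ => le_rfl, le_rfl⟩
      have h2 := hlin ⟨Pi.single i (-1), 0, 0, 0, 0⟩ ⟨fun _ => le_rfl, fun _ _ => le_rfl, le_rfl⟩
      simp [dualLagrangianLin, pairing_zero_right, Pi.single_apply] at h1 h2
      rw [one_div]
      linarith
    have hV : ∀ i, w.V i = (1 / (N : ℝ)) • (ξ i - ξhat i) := fun i => by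
      -- Taking `X_i` to be minus its own coefficient gives `-‖coefficient‖² ≥ 0`.
      have h1 := hlin ⟨0, 0, fun j => (if j = i then (-1 : ℝ) else 0) •
        (w.Γ i - w.μ i • ξhat i - w.V i), 0, 0⟩ ⟨fun _ => le_rfl, fun _ _ => le_rfl, le_rfl⟩
      simp only [dualLagrangianLin, pairing_smul_right] at h1
      simp only [ite_mul, Finset.sum_ite_eq', Finset.mem_univ, if_true, pairing_self, zero_mul,
        Pi.zero_apply, mul_zero, Finset.sum_const_zero, zero_add, add_zero] at h1
      have h2 := (pow_eq_zero_iff two_ne_zero).mp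
        (le_antisymm (by linarith) (sq_nonneg ‖w.Γ i - w.μ i • ξhat i - w.V i‖))
      have h1 := norm_eq_zero.mp h2
      rw [hw.2, hμ, ← smul_sub, sub_eq_zero] at h1
      exact h1.symm
    refine hξ ⟨?_, fun i => ⟨?_, fun m => ?_, ?_⟩⟩
    · have h1 := hlin ⟨0, 0, 0, 0, 1⟩ ⟨fun _ => le_rfl, fun _ _ => le_rfl, zero_le_one⟩
      have h2 : ∑ i, w.μ i = 1 := by simp [hμ]; field_simp
      have h3 : 1 / (N : ℝ) * ∑ i, ‖ξ i - ξhat i‖ ≤ ∑ i, w.r i := by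
        rw [Finset.mul_sum]
        refine Finset.sum_le_sum fun i _ => ?_
        have := hw.1.2.2 i
        rwa [hV, norm_smul, Real.norm_of_nonneg hN'.le] at this
      simp [dualLagrangianLin, pairing_zero_right, h2] at h1
      linarith
    · have := smul_mem_psdCone (hw.1.2.1 i) (Nat.cast_nonneg N)
      rwa [hw.2, smul_smul, mul_one_div_cancel (by positivity), one_smul] at this
    · have h1 := hlin ⟨0, 0, 0, Pi.single i (Pi.single m 1), 0⟩
        ⟨fun _ => le_rfl, fun j => ?_, le_rfl⟩
      · simp [dualLagrangianLin, pairing_zero_right, Pi.single_apply, apply_ite, ite_apply,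
          hw.2, linMap_smul] at h1
        exact nonneg_of_mul_nonneg_right h1 (by positivity)
      · exact (Pi.single_nonneg.mpr (Pi.single_nonneg.mpr zero_le_one) :
          (0 : Fin N → Fin M → ℝ) ≤ _) j
    · have h1 := hlin ⟨0, Pi.single i 1, 0, 0, 0⟩
        ⟨single_apply_nonneg i zero_le_one, fun _ _ => le_rfl, le_rfl⟩
      simp only [dualLagrangianLin, hμ, hw.2, pairing_smul_right] at h1
      simp [pairing_zero_right, Pi.single_apply] at h1
      have h2 : 0 ≤ 1 / (N : ℝ) * -D.initial (ξ i) := by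
        rw [PEPData.initial, one_div]; linarith
      linarith [nonneg_of_mul_nonneg_right h2 hN']

end Lagrangian


/-! ### Strong duality -/

section StrongDuality

theorem exists_coeff {ι : Type*} [Fintype ι] (g : (ι → ℝ) →ₗ[ℝ] ℝ) :
    ∃ y : ι → ℝ, ∀ u, g u = ∑ i, y i * u i := by
  classical
  exact ⟨_, fun u => (LinearMap.pi_apply_eq_sum_univ g u).trans
    (Finset.sum_congr rfl fun i _ => (mul_comm _ _))⟩

variable {Θ : Type*} {K M N : ℕ}

theorem exists_pairing_coeff (g : (Fin N → Lifted K) →L[ℝ] ℝ) :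
    ∃ X : Fin N → Lifted K, ∀ z, g z = ∑ i, pairing (X i) (z i) := by
  refine ⟨fun i => (InnerProductSpace.toDual ℝ (Lifted K)).symm
    (g.comp (ContinuousLinearMap.single ℝ (fun _ => Lifted K) i)), fun z => ?_⟩
  conv_lhs => rw [← Finset.univ_sum_single z, map_sum]
  refine Finset.sum_congr rfl fun i _ => ?_
  rw [pairing_eq_inner]
  exact (InnerProductSpace.toDual_symm_apply (𝕜 := ℝ) (E := Lifted K) (x := z i)
    (y := g.comp (ContinuousLinearMap.single ℝ (fun _ => Lifted K) i))).symm

/-- The space of perturbations of the constraints and of the objective of (DRO-PEP-P). -/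
abbrev Perturbation (K M N : ℕ) : Type :=
  (Fin N × Fin M → ℝ) × (Fin N → ℝ) × ℝ × (Fin N → Lifted K) × ℝ

theorem exists_perturbation_coeff (f : Perturbation K M N →L[ℝ] ℝ) :
    ∃ (y : Fin N × Fin M → ℝ) (τ : Fin N → ℝ) (lam : ℝ) (X : Fin N → Lifted K) (κ : ℝ),
      ∀ u v w z t, f (u, v, w, z, t) = ∑ j, y j * u j + ∑ i, τ i * v i + lam * w
        + ∑ i, pairing (X i) (z i) + κ * t := by
  obtain ⟨y, hy⟩ := exists_coeff (f.toLinearMap ∘ₗ LinearMap.inl ℝ _ _)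
  obtain ⟨τ, hτ⟩ := exists_coeff (f.toLinearMap ∘ₗ LinearMap.inr ℝ _ _ ∘ₗ LinearMap.inl ℝ _ _)
  obtain ⟨X, hX⟩ := exists_pairing_coeff
    (f ∘L .inr ℝ _ _ ∘L .inr ℝ _ _ ∘L .inr ℝ _ _ ∘L .inl ℝ _ _)
  refine ⟨y, τ, f (0, 0, 1, 0, 0), X, f (0, 0, 0, 0, 1), fun u v w z t => ?_⟩
  rw [← hy, ← hτ, ← hX, mul_comm _ w, mul_comm _ t, ← smul_eq_mul w, ← smul_eq_mul t, ← map_smul,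
    ← map_smul]
  simp only [LinearMap.coe_comp, Function.comp_apply, ContinuousLinearMap.coe_coe,
    LinearMap.inl_apply, LinearMap.inr_apply, ContinuousLinearMap.coe_comp,
    ContinuousLinearMap.inl_apply, ContinuousLinearMap.inr_apply, ← map_add]
  simp

variable (D : PEPData Θ K M) (θ : Θ) (ξhat : Fin N → Lifted K) (ε : ℝ)

/-- Pairs of a perturbation and a point that satisfies the perturbed constraints of (DRO-PEP-P)
and attains the perturbed objective level. -/
def perturbedGraph : Set (Perturbation K M N × (Fin N → Lifted K)) :=
  {q | (∀ i, q.2 i ∈ psdCone K) ∧ (∀ j, q.1.1 j ≤ D.linMap θ (q.2 j.1) j.2) ∧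
    (∀ i, q.1.2.1 i ≤ -D.initial (q.2 i)) ∧
    q.1.2.2.1 ≤ ε - 1 / (N : ℝ) * ∑ i, ‖q.2 i - ξhat i - q.1.2.2.2.1 i‖ ∧
    q.1.2.2.2.2 ≤ D.primalObj q.2}

theorem continuous_primalObj : Continuous (D.primalObj (N := N)) :=
  continuous_const.mul (continuous_finsetSum _ fun i _ =>
    (continuous_loss D).comp (continuous_apply i))

theorem isClosed_perturbedGraph : IsClosed (perturbedGraph D θ ξhat ε) := by
  refine IsClosed.inter ?_ (IsClosed.inter ?_ (IsClosed.inter ?_ (IsClosed.inter ?_ ?_)))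
  · change IsClosed {q : Perturbation K M N × (Fin N → Lifted K) | ∀ i, q.2 i ∈ psdCone K}
    rw [Set.ofPred_forall]
    exact isClosed_iInter fun i => isClosed_psdCone.preimage
      ((continuous_apply i).comp continuous_snd)
  · change IsClosed {q : Perturbation K M N × (Fin N → Lifted K) |
      ∀ j, q.1.1 j ≤ D.linMap θ (q.2 j.1) j.2}
    rw [Set.ofPred_forall]
    exact isClosed_iInter fun j => isClosed_le (by fun_prop)
      ((continuous_pairing _).comp ((continuous_apply j.1).comp continuous_snd)).neg
  · change IsClosed {q : Perturbation K M N × (Fin N → Lifted K) |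
      ∀ i, q.1.2.1 i ≤ -D.initial (q.2 i)}
    rw [Set.ofPred_forall]
    exact isClosed_iInter fun i => isClosed_le (by fun_prop)
      (((continuous_pairing _).comp ((continuous_apply i).comp continuous_snd)).add
        continuous_const).neg
  · change IsClosed {q : Perturbation K M N × (Fin N → Lifted K) |
      q.1.2.2.1 ≤ ε - 1 / (N : ℝ) * ∑ i, ‖q.2 i - ξhat i - q.1.2.2.2.1 i‖}
    exact isClosed_le (by fun_prop) (by fun_prop)
  · exact isClosed_le (by fun_prop) ((continuous_primalObj D).comp continuous_snd)

theorem primalObj_smul_add_smul (a b : ℝ) (ξ η : Fin N → Lifted K) :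
    D.primalObj (a • ξ + b • η) = a * D.primalObj ξ + b * D.primalObj η := by
  simp only [PEPData.primalObj, PEPData.loss, Pi.add_apply, Pi.smul_apply, pairing_add_right,
    pairing_smul_right, Finset.sum_add_distrib, ← Finset.mul_sum]
  ring

theorem convex_perturbedGraph : Convex ℝ (perturbedGraph D θ ξhat ε) := by
  rintro ⟨⟨u, v, w, z, t⟩, ξ⟩ ⟨h1, h2, h3, h4, h5⟩ ⟨⟨u', v', w', z', t'⟩, ξ'⟩
    ⟨h1', h2', h3', h4', h5'⟩ a b ha hb hab
  refine ⟨fun i => smul_add_smul_mem_psdCone (h1 i) (h1' i) ha hb, fun j => ?_, fun i => ?_, ?_, ?_⟩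
  · have := add_le_add (mul_le_mul_of_nonneg_left (h2 j) ha)
      (mul_le_mul_of_nonneg_left (h2' j) hb)
    refine this.trans_eq ?_
    simp only [PEPData.linMap, Prod.snd_add, Prod.smul_snd, Pi.add_apply, Pi.smul_apply,
      pairing_add_right, pairing_smul_right]
    ring
  · have := add_le_add (mul_le_mul_of_nonneg_left (h3 i) ha)
      (mul_le_mul_of_nonneg_left (h3' i) hb)
    refine this.trans_eq ?_
    simp only [PEPData.initial, Prod.snd_add, Prod.smul_snd, Pi.add_apply, Pi.smul_apply,
      pairing_add_right, pairing_smul_right]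
    linear_combination -D.c₀ * hab
  · have := add_le_add (mul_le_mul_of_nonneg_left h4 ha) (mul_le_mul_of_nonneg_left h4' hb)
    refine this.trans ?_
    have h6 : ∑ i, ‖(a • ξ + b • ξ') i - ξhat i - (a • z + b • z') i‖ ≤
        a * ∑ i, ‖ξ i - ξhat i - z i‖ + b * ∑ i, ‖ξ' i - ξhat i - z' i‖ := by
      rw [Finset.mul_sum, Finset.mul_sum, ← Finset.sum_add_distrib]
      refine Finset.sum_le_sum fun i _ => ?_
      have e : (a • ξ + b • ξ') i - ξhat i - (a • z + b • z') i =
          a • (ξ i - ξhat i - z i) + b • (ξ' i - ξhat i - z' i) := by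
        have : ξhat i = a • ξhat i + b • ξhat i := by rw [← add_smul, hab, one_smul]
        conv_lhs => rw [this]
        simp only [Pi.add_apply, Pi.smul_apply, smul_sub]
        abel
      rw [e]
      refine (norm_add_le _ _).trans_eq ?_
      rw [norm_smul, norm_smul, Real.norm_of_nonneg ha, Real.norm_of_nonneg hb]
    have h7 := mul_le_mul_of_nonneg_left h6 (show 0 ≤ 1 / (N : ℝ) by positivity)
    have h8 : a * ε + b * ε = ε := by rw [← add_mul, hab, one_mul]
    simp only [Prod.fst_add, Prod.snd_add, Prod.smul_fst, Prod.smul_snd]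
    linarith
  · have := add_le_add (mul_le_mul_of_nonneg_left h5 ha) (mul_le_mul_of_nonneg_left h5' hb)
    exact this.trans_eq (primalObj_smul_add_smul D a b ξ ξ').symm

theorem norm_le_of_mem_perturbedGraph (hN : 0 < N)
    {q : Perturbation K M N × (Fin N → Lifted K)} (hq : q ∈ perturbedGraph D θ ξhat ε) :
    ‖q.2‖ ≤ ‖ξhat‖ + ‖q.1.2.2.2.1‖ + N * |ε - q.1.2.2.1| := by
  rw [pi_norm_le_iff_of_nonneg (by positivity)]
  intro i
  obtain ⟨-, -, -, h, -⟩ := hq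
  have h1 : ‖q.2 i - ξhat i - q.1.2.2.2.1 i‖ ≤ ∑ i, ‖q.2 i - ξhat i - q.1.2.2.2.1 i‖ :=
    Finset.single_le_sum (f := fun i => ‖q.2 i - ξhat i - q.1.2.2.2.1 i‖)
      (fun _ _ => norm_nonneg _) (Finset.mem_univ i)
  have h2 : ∑ i, ‖q.2 i - ξhat i - q.1.2.2.2.1 i‖ ≤ N * |ε - q.1.2.2.1| := by
    have h3 : 1 / (N : ℝ) * ∑ i, ‖q.2 i - ξhat i - q.1.2.2.2.1 i‖ ≤ |ε - q.1.2.2.1| :=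
      le_trans (by linarith) (le_abs_self _)
    rwa [one_div, inv_mul_le_iff₀ (Nat.cast_pos.mpr hN)] at h3
  calc ‖q.2 i‖ = ‖ξhat i + q.1.2.2.2.1 i + (q.2 i - ξhat i - q.1.2.2.2.1 i)‖ := by
        congr 1; abel
    _ ≤ ‖ξhat i‖ + ‖q.1.2.2.2.1 i‖ + ‖q.2 i - ξhat i - q.1.2.2.2.1 i‖ := norm_add₃_le
    _ ≤ _ := by
      have := norm_le_pi_norm ξhat i
      have := norm_le_pi_norm q.1.2.2.2.1 i
      linarith

/-- A projection of a closed set need not be closed; here points above a convergent sequence of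
perturbations are bounded by `norm_le_of_mem_perturbedGraph`, so a subsequence converges. This
closedness replaces a constraint qualification. -/
theorem isClosed_fst_image_perturbedGraph (hN : 0 < N) :
    IsClosed (Prod.fst '' perturbedGraph D θ ξhat ε) := by
  refine IsSeqClosed.isClosed fun q q₀ hq hlim => ?_
  choose x hx hxq using hq
  have hR : Filter.Tendsto (fun n => ‖ξhat‖ + ‖(q n).2.2.2.1‖ + N * |ε - (q n).2.2.1|)
      Filter.atTop (nhds (‖ξhat‖ + ‖q₀.2.2.2.1‖ + N * |ε - q₀.2.2.1|)) :=
    ((by fun_prop : Continuous fun q : Perturbation K M N =>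
      ‖ξhat‖ + ‖q.2.2.2.1‖ + N * |ε - q.2.2.1|).tendsto q₀).comp hlim
  obtain ⟨R, hR⟩ := hR.bddAbove_range
  obtain ⟨ξ, -, φ, hφ, hξ⟩ := tendsto_subseq_of_bounded
    (Metric.isBounded_closedBall (x := (0 : Fin N → Lifted K)) (r := R))
    (x := fun n => (x n).2) fun n => by
      rw [mem_closedBall_zero_iff]
      refine (norm_le_of_mem_perturbedGraph D θ ξhat ε hN (hx n)).trans ?_
      rw [hxq]
      exact hR ⟨n, rfl⟩
  refine ⟨(q₀, ξ), (isClosed_perturbedGraph D θ ξhat ε).mem_of_tendsto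
    ((hlim.comp hφ.tendsto_atTop).prodMk_nhds hξ) (.of_forall fun n => ?_), rfl⟩
  simpa only [Function.comp_apply, ← hxq] using hx (φ n)

variable {D θ ξhat ε}

theorem nonneg_of_forall_add_mul_lt {a b c : ℝ} (h : ∀ t : ℝ, 0 ≤ t → a - t * b < c) : 0 ≤ b := by
  by_contra hb
  push Not at hb
  have h1 := h (max 0 ((a - c) / b)) (le_max_left _ _)
  have h2 := mul_le_mul_of_nonpos_right (le_max_right 0 ((a - c) / b)) hb.le
  rw [div_mul_cancel₀ _ hb.ne] at h2
  linarith

theorem exists_multipliers (hN : 0 < N) (hξ : ∀ i, ξhat i ∈ D.suppSet θ) (hε : 0 < ε) {p : ℝ}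
    (hp : D.primalValue θ ξhat ε < p) :
    ∃ (lam : ℝ) (X : Fin N → Lifted K) (τ : Fin N → ℝ) (y : Fin N → Fin M → ℝ),
      0 ≤ lam ∧ (∀ i, 0 ≤ τ i) ∧ (∀ i m, 0 ≤ y i m) ∧
      ∀ P : Fin N → Lifted K × Lifted K, (∀ i, (P i).1 ∈ psdCone K) →
        lam * ε + 1 / (N : ℝ) *
          ∑ i, D.innerLagrangian θ lam (ξhat i) (P i) (X i) (τ i) (y i) ≤ p := by
  have hlt : ∀ ξ ∈ D.primalFeasible θ ξhat ε, D.primalObj ξ < p := fun ξ hξ =>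
    EReal.coe_lt_coe_iff.mp ((le_iSup₂ (f := fun ξ (_ : ξ ∈ D.primalFeasible θ ξhat ε) =>
      (D.primalObj ξ : EReal)) ξ hξ).trans_lt hp)
  have hnot : ((0, 0, 0, 0, p) : Perturbation K M N) ∉ Prod.fst '' perturbedGraph D θ ξhat ε := by
    rintro ⟨⟨q, ξ⟩, ⟨h1, h2, h3, h4, h5⟩, rfl⟩
    refine (hlt ξ ⟨?_, fun i => ⟨h1 i, fun m => h2 (i, m), ?_⟩⟩).not_ge h5
    · simpa using h4
    · simpa using h3 i
  obtain ⟨f, c, hf, hc⟩ := geometric_hahn_banach_closed_point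
    ((convex_perturbedGraph D θ ξhat ε).linear_image (LinearMap.fst ℝ _ _))
    (isClosed_fst_image_perturbedGraph D θ ξhat ε hN) hnot
  obtain ⟨y, τ, lam, X, κ, hcoef⟩ := exists_perturbation_coeff f
  -- Lowering the perturbations of the inequalities at the feasible point `ξhat` stays in the set.
  -- As the functional is bounded above there, the corresponding coefficients are nonnegative; the
  -- shift `z` stays `0`, so `X` carries no sign.
  have hdown : ∀ (u : Fin N × Fin M → ℝ) (v : Fin N → ℝ) (w t : ℝ), 0 ≤ u → 0 ≤ v → 0 ≤ w → 0 ≤ t →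
      ∑ j, y j * -u j + ∑ i, τ i * -v i + lam * -w + κ * (D.primalObj ξhat - t) < c :=
    fun u v w t hu hv hw ht => by
      have := hf (-u, -v, -w, 0, D.primalObj ξhat - t) ⟨(_, ξhat), ⟨fun i => (hξ i).1,
        fun j => (neg_nonpos.mpr (hu j)).trans ((hξ j.1).2.1 j.2),
        fun i => (neg_nonpos.mpr (hv i)).trans (neg_nonneg.mpr (hξ i).2.2),
        by simp; linarith, sub_le_self _ ht⟩, rfl⟩
      rw [hcoef] at this
      simpa [pairing_zero_right] using this
  have hc' : c < κ * p := by
    rw [hcoef] at hc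
    simpa [pairing_zero_right] using hc
  -- The level of `ξhat` lies below `p`, yet `κ * D.primalObj ξhat < c < κ * p`.
  have hκ : 0 < κ := by
    have h1 := hdown 0 0 0 0 le_rfl le_rfl le_rfl le_rfl
    simp only [Pi.zero_apply, neg_zero, mul_zero, Finset.sum_const_zero, sub_zero, zero_add] at h1
    have h2 := hlt ξhat ⟨by simp [hε.le], hξ⟩
    by_contra hκ
    have := mul_le_mul_of_nonpos_left h2.le (not_lt.mp hκ)
    linarith
  have hlam : 0 ≤ lam := nonneg_of_forall_add_mul_lt (a := κ * D.primalObj ξhat) (c := c)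
    fun t ht => by
      have := hdown 0 0 t 0 le_rfl le_rfl ht le_rfl
      simp only [Pi.zero_apply, neg_zero, mul_zero, Finset.sum_const_zero, sub_zero] at this
      linarith
  have hτ : ∀ i, 0 ≤ τ i := fun i =>
    nonneg_of_forall_add_mul_lt (a := κ * D.primalObj ξhat) (c := c) fun t ht => by
      have := hdown 0 (Pi.single i t) 0 0 le_rfl (single_apply_nonneg i ht) le_rfl le_rfl
      simp [Pi.single_apply] at this
      linarith
  have hy : ∀ j, 0 ≤ y j := fun j =>
    nonneg_of_forall_add_mul_lt (a := κ * D.primalObj ξhat) (c := c) fun t ht => by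
      have := hdown (Pi.single j t) 0 0 0 (single_apply_nonneg j ht) le_rfl le_rfl le_rfl
      simp [Pi.single_apply] at this
      linarith
  have hN' : 0 < (N : ℝ) := Nat.cast_pos.mpr hN
  -- Division by `κ` normalizes the objective. The factor `N` cancels the `1 / N` before the sum of
  -- Lagrangians; the budget is already averaged, so `lam` takes no such factor.
  refine ⟨lam / κ, fun i => (N / κ) • X i, fun i => N / κ * τ i, fun i m => N / κ * y (i, m),
    by positivity, fun i => mul_nonneg (by positivity) (hτ i),
    fun i m => mul_nonneg (by positivity) (hy _), fun P hP => ?_⟩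
  -- Every perturbed inequality is taken with equality, and the shift `z = ξ - ξ̂ - ζ` leaves the
  -- residual `ζ`, so the functional becomes the sum of inner Lagrangians.
  have h1 := hf (fun j => D.linMap θ (P j.1).1 j.2, fun i => -D.initial (P i).1,
    ε - 1 / (N : ℝ) * ∑ i, ‖(P i).2‖, fun i => (P i).1 - ξhat i - (P i).2,
    D.primalObj fun i => (P i).1) ⟨(_, fun i => (P i).1), ⟨hP, fun j => le_rfl, fun i => le_rfl,
      by simp, le_rfl⟩, rfl⟩
  rw [hcoef] at h1
  have h2 : κ * (lam / κ * ε + 1 / (N : ℝ) * ∑ i, D.innerLagrangian θ (lam / κ) (ξhat i) (P i)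
      ((N / κ) • X i) (N / κ * τ i) (fun m => N / κ * y (i, m))) =
      ∑ j : Fin N × Fin M, y j * D.linMap θ (P j.1).1 j.2 + ∑ i, τ i * -D.initial (P i).1
        + lam * (ε - 1 / (N : ℝ) * ∑ i, ‖(P i).2‖)
        + ∑ i, pairing (X i) ((P i).1 - ξhat i - (P i).2)
        + κ * D.primalObj fun i => (P i).1 := by
    simp only [PEPData.innerLagrangian, PEPData.primalObj, pairing_smul_left,
      Finset.sum_add_distrib, Finset.sum_sub_distrib, mul_assoc, ← Finset.mul_sum,
      Fintype.sum_prod_type, mul_neg, Finset.sum_neg_distrib]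
    field_simp
    ring
  have h3 : κ * _ < κ * p := h2.trans_lt (h1.trans hc')
  exact (lt_of_mul_lt_mul_left h3 hκ.le).le

/-- Each real `p` above the primal value bounds the dual value; attainment of the dual is not
needed. The conic and norm constraints of the multipliers are not checked separately, since by
`iInf_dualObj` their failure would make the bounded quantity `⊤`. -/
theorem dualValue_le_primalValue (hN : 0 < N) (hξ : ∀ i, ξhat i ∈ D.suppSet θ) (hε : 0 < ε) :
    D.dualValue θ ξhat ε ≤ D.primalValue θ ξhat ε := by
  refine EReal.le_of_forall_lt_iff_le.mp fun p hp => ?_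
  obtain ⟨lam, X, τ, y, hlam, hτ, hy, hP⟩ := exists_multipliers hN hξ hε hp
  have h1 : (⨅ (s : Fin N → ℝ)
      (_ : (⟨s, τ, X, y, lam⟩ : DualVar K M N) ∈ D.dualFeasible θ ξhat ε),
      (dualObj (⟨s, τ, X, y, lam⟩ : DualVar K M N) : EReal)) ≤ p := by
    rw [iInf_dualObj D θ hN ξhat ε X hlam hτ hy]
    refine (iSup_coe_add_mean (lam * ε) (fun _ => psdCone K ×ˢ (Set.univ : Set (Lifted K)))
      (fun _ => ⟨(0, 0), zero_mem_psdCone, trivial⟩)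
      fun i p => D.innerLagrangian θ lam (ξhat i) p (X i) (τ i) (y i)).symm.trans_le ?_
    exact iSup₂_le fun P hPm => EReal.coe_le_coe_iff.mpr (hP P fun i => (hPm i).1)
  exact le_trans (le_iInf₂ fun s hs => iInf₂_le (f := fun v
    (_ : v ∈ D.dualFeasible θ ξhat ε) => (dualObj v : EReal)) ⟨s, τ, X, y, lam⟩ hs) h1

/-- At `(ξ, ξ - ξ̂ᵢ)` the inner Lagrangian dominates the inner objective, and it is itself bounded
by the inner dual function, which is at most `s_i - λ ε`. -/
theorem loss_sub_le_of_dualFeasible {v : DualVar K M N} (hv : v ∈ D.dualFeasible θ ξhat ε)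
    (i : Fin N) {ξ : Lifted K} (hξ : ξ ∈ D.suppSet θ) :
    D.loss ξ - v.lam * ‖ξ - ξhat i‖ ≤ v.s i - v.lam * ε := by
  obtain ⟨h1, h2, h3⟩ := hv.2 i
  have h4 := coe_le_innerDual D θ (lam := v.lam) (ξ₀ := ξhat i) (X := v.X i) (τ := v.τ i)
    (y := v.y i) (p := (ξ, ξ - ξhat i)) hξ.1
  rw [innerDual_of_feasible D θ _ h2 h3, EReal.coe_le_coe_iff] at h4
  have h5 : 0 ≤ ∑ m, v.y i m * D.linMap θ ξ m :=
    Finset.sum_nonneg fun m _ => mul_nonneg (hv.1.2.1 i m) (hξ.2.1 m)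
  have h6 := mul_nonneg_of_nonpos_of_nonpos (neg_nonpos.mpr (hv.1.1 i)) hξ.2.2
  simp only [PEPData.innerLagrangian, sub_self, pairing_zero_right] at h4
  linarith

theorem droValue_le_dualValue (hN : 0 < N) (hξ : ∀ i, ξhat i ∈ D.suppSet θ) (hε : 0 < ε) :
    D.droValue θ ξhat ε ≤ D.dualValue θ ξhat ε := by
  have : NeZero N := ⟨hN.ne'⟩
  refine iSup₂_le fun Q hQ => le_iInf₂ fun v hv => EReal.coe_le_coe_iff.mpr ?_
  have h1 := risk_le ⟨hQ.1, (hQ.2.trans_lt ENNReal.ofReal_lt_top).ne⟩ hv.1.2.2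
    ⟨_, hξ ⟨0, hN⟩⟩ fun i ξ hξ => loss_sub_le_of_dualFeasible hv i hξ
  have h2 := mul_le_mul_of_nonneg_left (ENNReal.toReal_le_of_le_ofReal hε.le hQ.2) hv.1.2.2
  have h3 : 1 / (N : ℝ) * ∑ i, (v.s i - v.lam * ε) = dualObj v - v.lam * ε := by
    have : (N : ℝ) ≠ 0 := (Nat.cast_pos.mpr hN).ne'
    rw [Finset.sum_sub_distrib, mul_sub, dualObj]
    simp
    field_simp
  linarith

/-- Each single distance is at most `N` times their mean, so the budget bounds the tuples even where
the support set is unbounded. -/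
theorem isCompact_primalFeasible (hN : 0 < N) : IsCompact (D.primalFeasible θ ξhat ε) := by
  refine Metric.isCompact_of_isClosed_isBounded (IsClosed.inter ?_ ?_) ?_
  · change IsClosed {ξ : Fin N → Lifted K | 1 / (N : ℝ) * ∑ i, ‖ξ i - ξhat i‖ ≤ ε}
    exact isClosed_le (by fun_prop) continuous_const
  · change IsClosed {ξ : Fin N → Lifted K | ∀ i, ξ i ∈ D.suppSet θ}
    rw [Set.ofPred_forall]
    exact isClosed_iInter fun i => (isClosed_suppSet D θ).preimage (continuous_apply i)
  · refine (Metric.isBounded_closedBall (x := ξhat) (r := N * |ε|)).subset fun ξ hξ => ?_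
    rw [mem_closedBall_iff_norm, pi_norm_le_iff_of_nonneg (by positivity)]
    intro i
    refine (Finset.single_le_sum (f := fun i => ‖ξ i - ξhat i‖) (fun _ _ => norm_nonneg _)
      (Finset.mem_univ i)).trans ?_
    have := hξ.1.trans (le_abs_self ε)
    rwa [one_div, inv_mul_le_iff₀ (Nat.cast_pos.mpr hN)] at this

end StrongDuality

end DROPEP

theorem mainTheorem4 {Θ : Type*} {K M N : ℕ} (hN : 0 < N) (D : DROPEP.PEPData Θ K M) (θ : Θ)
    (ξhat : Fin N → DROPEP.Lifted K) (hξ : ∀ i, ξhat i ∈ D.suppSet θ) (ε : ℝ) (hε : 0 < ε) :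
    -- all expectations in (DRO-PEP) and its Lagrangian are genuine
    (∀ Q ∈ D.finiteTransport θ ξhat,
      MeasureTheory.Integrable D.loss (Q : MeasureTheory.Measure (DROPEP.Lifted K))) ∧
    -- (DRO-PEP-P) is a bi-dual of (DRO-PEP): a dual of (DRO-PEP-D), which is a dual of (DRO-PEP)
    D.DualIsDualOfDRO θ ξhat ε ∧ D.PrimalIsDualOfDual θ ξhat ε ∧
    -- the optimal values coincide
    D.droValue θ ξhat ε = D.primalValue θ ξhat ε ∧
    D.dualValue θ ξhat ε = D.primalValue θ ξhat ε ∧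
    -- (DRO-PEP-P) has an optimal solution
    (∃ ξ ∈ D.primalFeasible θ ξhat ε,
      ∀ ξ' ∈ D.primalFeasible θ ξhat ε, D.primalObj ξ' ≤ D.primalObj ξ) := by
  have : NeZero N := ⟨hN.ne'⟩
  have h1 := DROPEP.primalValue_le_droValue (D := D) (θ := θ) (ξhat := ξhat) ε
  have h2 := DROPEP.droValue_le_dualValue hN hξ hε
  have h3 := DROPEP.dualValue_le_primalValue hN hξ hε
  refine ⟨fun Q hQ => DROPEP.integrable_loss_of_mem_finiteTransport hQ,
    ⟨fun Q hQ => DROPEP.iInf_droLagrangian hε hQ,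
      fun lam hlam => DROPEP.iSup_droLagrangian hξ ε hlam,
      fun lam _ i p hp => DROPEP.iInf_innerLagrangian D θ lam (ξhat i) hp.1,
      fun lam X τ y hlam hτ hy => DROPEP.iInf_dualObj D θ hN ξhat ε X hlam hτ hy⟩,
    ⟨fun v hv => DROPEP.iSup_dualLagrangian D θ ξhat ε hv,
      DROPEP.iSup_iInf_dualLagrangian D θ ξhat ε hN⟩,
    le_antisymm (h2.trans h3) h1, le_antisymm h3 (h1.trans h2), ?_⟩
  obtain ⟨ξ, hξ, hmax⟩ := (DROPEP.isCompact_primalFeasible (D := D) (θ := θ)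
    (ξhat := ξhat) (ε := ε) hN).exists_isMaxOn
    ⟨ξhat, by simp [hε.le], hξ⟩ (DROPEP.continuous_primalObj D).continuousOn
  exact ⟨ξ, hξ, fun ξ' hξ' => hmax hξ'⟩
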